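/- Let $n,d$ be non-negative integers, $T\in(0,\infty)$, $p\in(1,\infty)$, $\mathbb T^d=(\mathbb R/2\pi\mathbb Z)^d$, $Q_T=\mathbb T^d\times[0,T)$ and $\overline{Q_T}=\mathbb T^d\times[0,T]$. Consider the system $$\partial_t A(u)+\sum_{\alpha=1}^d\partial_\alpha F_\alpha(u)=0,\qquad u=u(x,t)\in\mathbb R^n, \qquad (1)$$ where $A,F_\alpha:\mathbb R^n\to\mathbb R^n$ are $C^2$. Assume: (H1) $A$ is one-to-one and $\nabla A(u)$ is nonsingular for every $u\in\mathbb R^n$. (H2) There are $\eta\in C^2(\mathbb R^n;\mathbb R)$, $q_\alpha\in C^1(\mathbb R^n;\mathbb R)$ ($\alpha=1,\dots,d$) and $G\in C^1(\mathbb R^n;\mathbb R^n)$ with $\nabla\eta=G\cdot\nabla A$ and $\nabla q_\alpha=G\cdot\nabla F_\alpha$. (H3) $\xi\cdot\big(\nabla^2\eta(u)-G(u)\cdot\nabla^2A(u)\big)\xi>0$ for all $u\in\mathbb R^n$ and $\xi\in\mathbb R^n\setminus\{0\}$, where $G\cdot\nabla^2A=\sum_kG_k\nabla^2A_k$. Assume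 further that $\eta\ge0$ and that (A1) $\beta_1(|u|^p+1)-B\le\eta(u)\le\beta_2(|u|^p+1)$ for all $u\in\mathbb R^n$, with some positive constants $\beta_1,\beta_2,B$; (A2) $|F_\alpha(u)|/\eta(u)\to0$ as $|u|\to\infty$, for every $\alpha$; (A3) $|A(u)|/\eta(u)\to0$ as $|u|\to\infty$; (A4) $\frac1C(|A(u)|^r+1)-B'\le\eta(u)\le C(|A(u)|^r+1)$ for all $u\in\mathbb R^n$, with some $r>1$ and $C,B'>0$. Let $u\in C([0,T];L^p(\mathbb T^d;\mathbb R^n))$, with the exponent $p$ of (A1), be an entropy weak solution of (1): $u$ satisfies (1), and $\partial_t\eta(u)+\sum_\alpha\partial_\alpha q_\alpha(u)\le0$, in the sense of distributions on $\mathbb T^d\times(0,T)$ (where the functions $A(u),F_\alpha(u),\eta(u),q_\alpha(u)$ are locally integrable). Let $\bar u\in W^{1,\infty}(\overline{Q_T};\mathbb R^n)$ (weak first derivatives in $L^\infty$; $\bar u$ denotes the representative that is continuous on $\overline{Q_T}$) be a strong solution of (1), i.e. $\nabla A(\bar u)\,\partial_t\bar u+\sum_\alpha\nabla F_\alpha(\bar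 u)\,\partial_\alpha\bar u=0$ almost everywhere on $Q_T$. Let $u_0=u(\cdot,0)$ and $\bar u_0=\bar u(\cdot,0)$ be the initial data. If $u_0=\bar u_0$ almost everywhere on $\mathbb T^d$, then $u=\bar u$ almost everywhere on $Q_T$. -/

import Mathlib

open MeasureTheory Set Filter Topology
open scoped ContDiff

noncomputable section

namespace HypCL

/-- The state space `ℝⁿ` with its Euclidean norm. -/
abbrev State (n : ℕ) : Type := EuclideanSpace ℝ (Fin n)

instance factTwoPiPos : Fact (0 < 2 * Real.pi) := ⟨Real.two_pi_pos⟩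

/-- The torus `𝕋ᵈ = (ℝ / 2πℤ)ᵈ`; its `volume` is the product of the Lebesgue measures, of total
mass `(2π)ᵈ`. -/
abbrev Torus (d : ℕ) : Type := Fin d → AddCircle (2 * Real.pi)

/-- The quotient map `ℝᵈ → 𝕋ᵈ`. -/
def toTorus {d : ℕ} (x : Fin d → ℝ) : Torus d := fun i => (x i : AddCircle (2 * Real.pi))

/-- The space-time cylinder `[0,T) × 𝕋ᵈ` (time is the first coordinate). -/
def cyl (d : ℕ) (T : ℝ) : Set (ℝ × Torus d) := Ico 0 T ×ˢ univ

/-- The open cylinder `(0,T) × 𝕋ᵈ`. -/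
def openCyl (d : ℕ) (T : ℝ) : Set (ℝ × Torus d) := Ioo 0 T ×ˢ univ

/-- The closed cylinder `[0,T] × 𝕋ᵈ`. -/
def closedCyl (d : ℕ) (T : ℝ) : Set (ℝ × Torus d) := Icc 0 T ×ˢ univ

/-- Classical partial derivative in time. -/
def dt {d : ℕ} (φ : ℝ × Torus d → ℝ) (z : ℝ × Torus d) : ℝ :=
  deriv (fun s : ℝ => φ (s, z.2)) z.1

/-- Classical partial derivative in the space direction `α`, taken along the translations of the
torus in the `α`-th coordinate. -/
def dx {d : ℕ} (α : Fin d) (φ : ℝ × Torus d → ℝ) (z : ℝ × Torus d) : ℝ :=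
  deriv (fun h : ℝ => φ (z.1, z.2 + toTorus (Pi.single α h))) 0

/-- Test functions `φ ∈ C_c^∞((0,T) × 𝕋ᵈ)`. Smoothness is that of the lift to `ℝ × ℝᵈ`; the
torus being compact, compact support is a condition on time only. -/
structure IsTest {d : ℕ} (T : ℝ) (φ : ℝ × Torus d → ℝ) : Prop where
  smooth : ContDiff ℝ ∞ (fun y : ℝ × (Fin d → ℝ) => φ (y.1, toTorus y.2))
  supp : ∃ a b : ℝ, 0 < a ∧ b < T ∧ ∀ z : ℝ × Torus d, z.1 ∉ Icc a b → φ z = 0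

/-- `w` is the weak time derivative of `v` on `(0,T) × 𝕋ᵈ`. -/
def IsWeakDt {d n : ℕ} (T : ℝ) (v w : ℝ × Torus d → State n) : Prop :=
  ∀ φ : ℝ × Torus d → ℝ, IsTest T φ →
    ∫ z in cyl d T, dt φ z • v z = - ∫ z in cyl d T, φ z • w z

/-- `w` is the weak derivative of `v` in the space direction `α` on `(0,T) × 𝕋ᵈ`. -/
def IsWeakDx {d n : ℕ} (T : ℝ) (α : Fin d) (v w : ℝ × Torus d → State n) : Prop :=
  ∀ φ : ℝ × Torus d → ℝ, IsTest T φ →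
    ∫ z in cyl d T, dx α φ z • v z = - ∫ z in cyl d T, φ z • w z

/-- `v ∈ C([0,T]; L^p(𝕋ᵈ; ℝⁿ))`, for a representative `v` that is jointly measurable. -/
structure IsContLp {d n : ℕ} (T p : ℝ) (v : ℝ × Torus d → State n) : Prop where
  meas : AEStronglyMeasurable v (volume.restrict (cyl d T))
  memLp : ∀ t ∈ Icc 0 T, MemLp (fun x : Torus d => v (t, x)) (ENNReal.ofReal p) volume
  cont : ∀ s ∈ Icc 0 T,
    Tendsto (fun t : ℝ => eLpNorm (fun x : Torus d => v (t, x) - v (s, x)) (ENNReal.ofReal p) volume)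
      (𝓝[Icc 0 T] s) (𝓝 0)

/-- `u` is a weak solution of `∂ₜ A(u) + ∑_α ∂_α F_α(u) = 0` on `(0,T) × 𝕋ᵈ`, in the sense of
distributions. -/
structure IsWeakSolution {d n : ℕ} (T : ℝ) (A : State n → State n)
    (F : Fin d → State n → State n) (u : ℝ × Torus d → State n) : Prop where
  locInt_A : LocallyIntegrableOn (fun z => A (u z)) (openCyl d T)
  locInt_F : ∀ α, LocallyIntegrableOn (fun z => F α (u z)) (openCyl d T)
  eqn : ∀ φ : ℝ × Torus d → ℝ, IsTest T φ →
    ∫ z in cyl d T, (dt φ z • A (u z) + ∑ α, dx α φ z • F α (u z)) = 0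

/-- `u` is an entropy weak solution: a weak solution with
`∂ₜ η(u) + ∑_α ∂_α q_α(u) ≤ 0` on `(0,T) × 𝕋ᵈ`, in the sense of distributions. -/
structure IsEntropyWeakSolution {d n : ℕ} (T : ℝ) (A : State n → State n)
    (F : Fin d → State n → State n) (η : State n → ℝ) (q : Fin d → State n → ℝ)
    (u : ℝ × Torus d → State n) : Prop extends IsWeakSolution T A F u where
  locInt_η : LocallyIntegrableOn (fun z => η (u z)) (openCyl d T)
  locInt_q : ∀ α, LocallyIntegrableOn (fun z => q α (u z)) (openCyl d T)
  entropy : ∀ φ : ℝ × Torus d → ℝ, IsTest T φ → (∀ z, 0 ≤ φ z) →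
    0 ≤ ∫ z in cyl d T, (dt φ z * η (u z) + ∑ α, dx α φ z * q α (u z))

/-- `v ∈ W^{1,∞}` is a strong solution of `∂ₜ A(v) + ∑_α ∂_α F_α(v) = 0`: it is essentially bounded,
has essentially bounded weak first derivatives, which satisfy the equation (in its chain rule form)
almost everywhere, and `v` denotes the representative that is continuous up to `t = 0` and `t = T`,
so that its initial values are `v (0, ·)`. -/
structure IsStrongSolution {d n : ℕ} (T : ℝ) (A : State n → State n)
    (F : Fin d → State n → State n) (v : ℝ × Torus d → State n) : Prop where
  cont : ContinuousOn v (closedCyl d T)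
  bdd : MemLp v ⊤ (volume.restrict (cyl d T))
  eqn : ∃ (wt : ℝ × Torus d → State n) (wx : Fin d → ℝ × Torus d → State n),
    MemLp wt ⊤ (volume.restrict (cyl d T)) ∧ IsWeakDt T v wt ∧
    (∀ α, MemLp (wx α) ⊤ (volume.restrict (cyl d T)) ∧ IsWeakDx T α v (wx α)) ∧
    ∀ᵐ z ∂(volume.restrict (cyl d T)),
      fderiv ℝ A (v z) (wt z) + ∑ α, fderiv ℝ (F α) (v z) (wx α z) = 0

/-- `(η, q)` is an entropy pair for `(A, F)` with multiplier `G`: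
`∇η = G · ∇A` and `∇q_α = G · ∇F_α`. -/
structure IsEntropyPair {d n : ℕ} (A : State n → State n) (F : Fin d → State n → State n)
    (η : State n → ℝ) (q : Fin d → State n → ℝ) (G : State n → State n) : Prop where
  smooth_η : ContDiff ℝ 2 η
  smooth_q : ∀ α, ContDiff ℝ 1 (q α)
  smooth_G : ContDiff ℝ 1 G
  grad_η : ∀ u ξ, fderiv ℝ η u ξ = inner ℝ (G u) (fderiv ℝ A u ξ)
  grad_q : ∀ α u ξ, fderiv ℝ (q α) u ξ = inner ℝ (G u) (fderiv ℝ (F α) u ξ)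

end HypCL

end

open HypCL

/-!
Relative entropy method. In the conserved variables `A(u)` the entropy is strictly convex, so the
relative entropy `η(u|ū) = η(u) - η(ū) - G(ū) · (A(u) - A(ū))` is nonnegative and vanishes only for
`u = ū`. Testing the entropy inequality with `φ(t)` and the equation for `u` with `φ(t) G(ū)` gives
`∂ₜ ∫ η(u|ū) dx ≤ -∫ ∑ᵢ ∂ᵢ G(ū) · fᵢ(u|ū) dx`, where `fᵢ(u|ū)` is the remainder of the first-order
expansion of the flux `Fᵢ` in terms of `A(u) - A(ū)`: the symmetry of `∇Gᵀ ∇Fᵢ` and the equation for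
`ū` remove the linear terms. As `G(ū)` is only Lipschitz, it is admitted as a test function by
mollification. On bounded sets of `u` the remainder `fᵢ(u|ū)` is quadratic in
`A(u) - A(ū)`, like `η(u|ū)`; at infinity it is `o(η(u))`, while `η(u|ū)` is comparable to `η(u)`.
Hence `∂ₜ ∫ η(u|ū) dx ≤ Λ ∫ η(u|ū) dx`, and Grönwall's lemma concludes, the relative entropy tending
to `0` as `t → 0` because `η(u)` grows at most like `|u|ᵖ`.
-/

noncomputable section

namespace HypCL

open scoped Convolution

/-! ### Approximate identities -/

section ApproximateIdentity

open ContinuousLinearMap Function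

variable {G E : Type*}

theorem convolution_sub_apply [AddCommGroup G] [MeasurableSpace G] {μ : Measure G}
    [NormedAddCommGroup E] [NormedSpace ℝ E] [CompleteSpace E] {ρ : G → ℝ}
    (hρ : Integrable ρ μ) (h_one : ∫ t, ρ t ∂μ = 1) {f : G → E} {z : G}
    (hz : ConvolutionExistsAt ρ f z (lsmul ℝ ℝ) μ) :
    (ρ ⋆[lsmul ℝ ℝ, μ] f) z - f z = ∫ t, ρ t • (f (z - t) - f z) ∂μ := by
  simp only [smul_sub]
  rw [integral_sub (by exact hz) (hρ.smul_const _), integral_smul_const, h_one, one_smul,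
    convolution_lsmul]

variable [AddCommGroup G] [TopologicalSpace G] [IsTopologicalAddGroup G]
  [MeasurableSpace G] [BorelSpace G] {μ : Measure G} [μ.IsAddLeftInvariant]
  [NormedAddCommGroup E]

theorem tendsto_eLpNorm_comp_add_left_sub [IsLocallyFiniteMeasure μ]
    [μ.InnerRegularCompactLTTop] {f : G → E} {p : ENNReal} (hp : 1 ≤ p) (hp_top : p ≠ ⊤)
    (hf : MemLp f p μ) :
    Tendsto (fun t => eLpNorm (fun z => f (t + z) - f z) p μ) (𝓝 0) (𝓝 0) := by
  have : Fact (1 ≤ p) := ⟨hp⟩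
  have : Fact (p ≠ ⊤) := ⟨hp_top⟩
  have hcont : Continuous fun t : G => DomAddAct.mk t +ᵥ hf.toLp f :=
    DomAddAct.continuous_mk.vadd continuous_const
  have h := tendsto_iff_edist_tendsto_0.1 (hcont.tendsto 0)
  simp only [DomAddAct.mk_zero, zero_vadd, DomAddAct.mk_vadd_toLp, Lp.edist_toLp_toLp] at h
  exact h

variable [NormedSpace ℝ E] [SFinite μ] [SecondCountableTopology G]

theorem eLpNorm_one_convolution_sub_le [CompleteSpace E] {ρ : G → ℝ} (hρ : Integrable ρ μ)
    (h_one : ∫ t, ρ t ∂μ = 1) {f : G → E} (hf : Integrable f μ) :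
    eLpNorm ((ρ ⋆[lsmul ℝ ℝ, μ] f) - f) 1 μ ≤
      ∫⁻ t, ‖ρ t‖ₑ * eLpNorm (fun z => f (z - t) - f z) 1 μ ∂μ := by
  have hmeas : AEStronglyMeasurable (fun x : G × G => ρ x.2 • (f (x.1 - x.2) - f x.1))
      (μ.prod μ) := by
    simp only [smul_sub]
    exact (hρ.convolution_integrand (lsmul ℝ ℝ) hf).aestronglyMeasurable.sub
      (hρ.aestronglyMeasurable.comp_snd.smul hf.aestronglyMeasurable.comp_fst)
  simp only [eLpNorm_one_eq_lintegral_enorm]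
  calc ∫⁻ z, ‖((ρ ⋆[lsmul ℝ ℝ, μ] f) - f) z‖ₑ ∂μ
      ≤ ∫⁻ z, ∫⁻ t, ‖ρ t • (f (z - t) - f z)‖ₑ ∂μ ∂μ := by
        refine lintegral_mono_ae ?_
        filter_upwards [hρ.ae_convolution_exists (lsmul ℝ ℝ) hf] with z hz
        rw [Pi.sub_apply, convolution_sub_apply hρ h_one hz]
        exact enorm_integral_le_lintegral_enorm _
    _ = ∫⁻ t, ∫⁻ z, ‖ρ t • (f (z - t) - f z)‖ₑ ∂μ ∂μ := lintegral_lintegral_swap hmeas.enorm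
    _ = ∫⁻ t, ‖ρ t‖ₑ * ∫⁻ z, ‖f (z - t) - f z‖ₑ ∂μ ∂μ := by
        simp only [enorm_smul, lintegral_const_mul' _ _ enorm_ne_top]

theorem tendsto_eLpNorm_one_convolution_sub [IsLocallyFiniteMeasure μ]
    [μ.InnerRegularCompactLTTop] [CompleteSpace E]
    {ι : Type*} {l : Filter ι} {ρ : ι → G → ℝ} (h_nonneg : ∀ i t, 0 ≤ ρ i t)
    (h_int : ∀ i, Integrable (ρ i) μ) (h_one : ∀ i, ∫ t, ρ i t ∂μ = 1)
    (h_supp : Tendsto (fun i => support (ρ i)) l (𝓝 0).smallSets)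
    {f : G → E} (hf : Integrable f μ) :
    Tendsto (fun i => eLpNorm ((ρ i ⋆[lsmul ℝ ℝ, μ] f) - f) 1 μ) l (𝓝 0) := by
  refine ENNReal.tendsto_nhds_zero.2 fun ε hε => ?_
  have htrans : ∀ᶠ t in 𝓝 (0 : G), eLpNorm (fun z => f (z - t) - f z) 1 μ ≤ ε := by
    have h := (tendsto_eLpNorm_comp_add_left_sub le_rfl ENNReal.one_ne_top
      (memLp_one_iff_integrable.2 hf)).comp ((continuous_neg (G := G)).tendsto' 0 0 neg_zero)
    simpa only [comp_apply, neg_add_eq_sub] using ENNReal.tendsto_nhds_zero.1 h ε hε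
  filter_upwards [h_supp.eventually (eventually_smallSets.2 ⟨_, htrans, fun _ => id⟩)] with i hi
  calc eLpNorm ((ρ i ⋆[lsmul ℝ ℝ, μ] f) - f) 1 μ
      ≤ ∫⁻ t, ‖ρ i t‖ₑ * eLpNorm (fun z => f (z - t) - f z) 1 μ ∂μ :=
        eLpNorm_one_convolution_sub_le (h_int i) (h_one i) hf
    _ ≤ ∫⁻ t, ‖ρ i t‖ₑ * ε ∂μ := by
        refine lintegral_mono fun t => ?_
        by_cases ht : t ∈ support (ρ i)
        · exact mul_le_mul_right (hi ht) _
        · simp [notMem_support.1 ht]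
    _ = ε := by
        rw [lintegral_mul_const'' _ (h_int i).aestronglyMeasurable.enorm,
          ← ofReal_integral_norm_eq_lintegral_enorm (h_int i)]
        simp only [Real.norm_of_nonneg (h_nonneg i _), h_one i, ENNReal.ofReal_one, one_mul]

end ApproximateIdentity

/-! ### Calculus on space-time -/

section SpaceTime

open ContinuousLinearMap Function

/-- Space-time `ℝ × 𝕋ᵈ`. -/
abbrev SpaceTime (d : ℕ) : Type := ℝ × Torus d

instance {d : ℕ} : (volume : Measure (SpaceTime d)).IsAddHaarMeasure :=
  Measure.prod.instIsAddHaarMeasure (volume : Measure ℝ) (volume : Measure (Torus d))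

instance {d : ℕ} : (volume : Measure (SpaceTime d)).Regular :=
  Measure.Regular.of_sigmaCompactSpace_of_isLocallyFiniteMeasure _

/-- The part of space-time with times in `[a, b]`. -/
def slab (d : ℕ) (a b : ℝ) : Set (SpaceTime d) := Icc a b ×ˢ univ

/-- The covering map `ℝ × ℝᵈ → ℝ × 𝕋ᵈ`. -/
def cover {d : ℕ} (y : ℝ × (Fin d → ℝ)) : SpaceTime d := (y.1, toTorus y.2)

/-- The coordinate directions of space-time, lifted to `ℝ × ℝᵈ`; here and in the sequel they are
indexed by `Option (Fin d)`, where `none` stands for time. -/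
def unitVec {d : ℕ} : Option (Fin d) → ℝ × (Fin d → ℝ)
  | none => (1, 0)
  | some α => (0, Pi.single α 1)

/-- The displacement of space-time by `s` in the `i`-th coordinate direction. -/
def shift {d : ℕ} (i : Option (Fin d)) (s : ℝ) : SpaceTime d := cover (s • unitVec i)

variable {d : ℕ}

theorem mem_slab {a b : ℝ} {z : SpaceTime d} : z ∈ slab d a b ↔ z.1 ∈ Icc a b := by
  simp [slab]

theorem isCompact_slab (a b : ℝ) : IsCompact (slab d a b) := isCompact_Icc.prod isCompact_univ

theorem measurableSet_slab (a b : ℝ) : MeasurableSet (slab d a b) :=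
  measurableSet_Icc.prod MeasurableSet.univ

theorem volume_slab_ne_top (a b : ℝ) : volume (slab d a b) ≠ ⊤ :=
  (isCompact_slab a b).measure_lt_top.ne

theorem hasCompactSupport_of_support_subset_slab {E : Type*} [Zero E] {a b : ℝ}
    {f : SpaceTime d → E} (hf : support f ⊆ slab d a b) : HasCompactSupport f :=
  HasCompactSupport.of_support_subset_isCompact (isCompact_slab a b) hf

theorem toTorus_add (x y : Fin d → ℝ) : toTorus (x + y) = toTorus x + toTorus y := by
  ext i; simp [toTorus]

theorem toTorus_zero : toTorus (0 : Fin d → ℝ) = 0 := by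
  ext; simp [toTorus]

theorem isOpenQuotientMap_cover : IsOpenQuotientMap (cover (d := d)) :=
  IsOpenQuotientMap.id.prodMap
    (IsOpenQuotientMap.piMap fun _ : Fin d => QuotientAddGroup.isOpenQuotientMap_mk)

theorem cover_add (x y : ℝ × (Fin d → ℝ)) : cover (x + y) = cover x + cover y := by
  simp [cover, toTorus_add]

theorem shift_none (s : ℝ) : (shift none s : SpaceTime d) = (s, 0) := by
  simp [shift, unitVec, cover, toTorus_zero]

theorem shift_some (α : Fin d) (s : ℝ) :
    shift (some α) s = (0, toTorus (Pi.single α s)) := by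
  simp [shift, unitVec, cover, ← Pi.single_smul]

theorem shift_zero (i : Option (Fin d)) : (shift i 0 : SpaceTime d) = 0 := by
  simp [shift, cover, toTorus_zero]

theorem shift_add (i : Option (Fin d)) (s t : ℝ) :
    (shift i (s + t) : SpaceTime d) = shift i s + shift i t := by
  simp [shift, add_smul, cover_add]

theorem continuous_shift (i : Option (Fin d)) : Continuous (shift i : ℝ → SpaceTime d) :=
  isOpenQuotientMap_cover.continuous.comp (continuous_id.smul continuous_const)

variable {E E' E'' : Type*} [NormedAddCommGroup E] [NormedSpace ℝ E] [NormedAddCommGroup E']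
  [NormedSpace ℝ E'] [NormedAddCommGroup E''] [NormedSpace ℝ E'']

/-- The partial derivative in the `i`-th coordinate direction, so that `dt` is `pderiv none` and
`dx α` is `pderiv (some α)`. -/
def pderiv (i : Option (Fin d)) (f : SpaceTime d → E) (z : SpaceTime d) : E :=
  deriv (fun s : ℝ => f (z + shift i s)) 0

theorem pderiv_none (φ : SpaceTime d → ℝ) : pderiv none φ = dt φ := by
  ext z
  simpa [pderiv, dt, shift_none, Prod.add_def] using
    deriv_comp_const_add (f := fun s : ℝ => φ (s, z.2)) z.1 0

theorem pderiv_some (α : Fin d) (φ : SpaceTime d → ℝ) : pderiv (some α) φ = dx α φ := by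
  ext z
  simp [pderiv, dx, shift_some, Prod.add_def]

theorem support_pderiv_subset (i : Option (Fin d)) (f : SpaceTime d → E) :
    support (pderiv i f) ⊆ tsupport f := by
  refine support_subset_iff'.2 fun z hz => ?_
  have hcont : Continuous fun s : ℝ => z + shift i s := continuous_const.add (continuous_shift i)
  have hev : (fun s : ℝ => f (z + shift i s)) =ᶠ[𝓝 0] fun _ => (0 : E) :=
    (notMem_tsupport_iff_eventuallyEq.1 hz).comp_tendsto
      (hcont.tendsto' 0 z (by rw [shift_zero, add_zero]))
  rw [pderiv, hev.deriv_eq, deriv_const]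

theorem support_pderiv_subset_slab {a b : ℝ} {f : SpaceTime d → E} (hf : support f ⊆ slab d a b)
    (i : Option (Fin d)) : support (pderiv i f) ⊆ slab d a b :=
  (support_pderiv_subset i f).trans (closure_minimal hf (isCompact_slab a b).isClosed)

theorem hasCompactSupport_pderiv {f : SpaceTime d → E} (hf : HasCompactSupport f)
    (i : Option (Fin d)) : HasCompactSupport (pderiv i f) :=
  hf.mono' (support_pderiv_subset i f)

/-- Continuously differentiable functions on space-time. -/
structure IsC1 (f : SpaceTime d → E) : Prop where
  continuous : Continuous f
  hasDerivAt_zero : ∀ i z, HasDerivAt (fun s : ℝ => f (z + shift i s)) (pderiv i f z) 0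
  continuous_pderiv : ∀ i, Continuous (pderiv i f)

theorem isC1_of_hasDerivAt {f : SpaceTime d → E} (f' : Option (Fin d) → SpaceTime d → E)
    (hf : Continuous f) (h : ∀ i z, HasDerivAt (fun s : ℝ => f (z + shift i s)) (f' i z) 0)
    (h' : ∀ i, Continuous (f' i)) : IsC1 f := by
  have hpd : ∀ i, pderiv i f = f' i := fun i => funext fun z => (h i z).deriv
  exact ⟨hf, fun i z => hpd i ▸ h i z, fun i => hpd i ▸ h' i⟩

theorem isC1_of_contDiff_cover {f : SpaceTime d → E} (hf : ContDiff ℝ 1 fun y => f (cover y)) :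
    IsC1 f := by
  have hderiv : ∀ i y, HasDerivAt (fun s : ℝ => f (cover y + shift i s))
      (fderiv ℝ (fun y => f (cover y)) y (unitVec i)) 0 := by
    intro i y
    have hline : HasDerivAt (fun s : ℝ => y + s • unitVec i) (unitVec i) 0 := by
      simpa using ((hasDerivAt_id (0 : ℝ)).smul_const (unitVec i)).const_add y
    have hf' : HasFDerivAt (fun y => f (cover y)) (fderiv ℝ (fun y => f (cover y)) y)
        (y + (0 : ℝ) • unitVec i) := by
      simpa using (hf.differentiable one_ne_zero y).hasFDerivAt
    simpa [comp_def, cover_add, shift] using hf'.comp_hasDerivAt (0 : ℝ) hline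
  have hpd : ∀ i y, pderiv i f (cover y) = fderiv ℝ (fun y => f (cover y)) y (unitVec i) :=
    fun i y => (hderiv i y).deriv
  refine ⟨isOpenQuotientMap_cover.isQuotientMap.continuous_iff.2 hf.continuous, fun i z => ?_,
    fun i => isOpenQuotientMap_cover.isQuotientMap.continuous_iff.2 ?_⟩
  · obtain ⟨y, rfl⟩ := isOpenQuotientMap_cover.surjective z
    exact hpd i y ▸ hderiv i y
  · exact ((hf.continuous_fderiv one_ne_zero).clm_apply continuous_const).congr
      fun y => (hpd i y).symm

theorem IsTest.isC1 {T : ℝ} {φ : SpaceTime d → ℝ} (hφ : IsTest T φ) : IsC1 φ :=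
  isC1_of_contDiff_cover (hφ.smooth.of_le (by exact_mod_cast le_top))

theorem IsC1.hasDerivAt {f : SpaceTime d → E} (hf : IsC1 f) (i : Option (Fin d))
    (z : SpaceTime d) (s : ℝ) :
    HasDerivAt (fun s : ℝ => f (z + shift i s)) (pderiv i f (z + shift i s)) s := by
  have h : HasDerivAt (fun r : ℝ => f (z + shift i s + shift i (r - s)))
      (pderiv i f (z + shift i s)) s :=
    HasDerivAt.comp_sub_const s s (f := fun r => f (z + shift i s + shift i r))
      (by simpa using hf.hasDerivAt_zero i (z + shift i s))
  simpa only [add_assoc, ← shift_add, add_sub_cancel] using h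

theorem IsC1.comp_hasDerivAt {v : SpaceTime d → E} (hv : IsC1 v) {g : E → E'}
    (hg : ContDiff ℝ 1 g) (i : Option (Fin d)) (z : SpaceTime d) :
    HasDerivAt (fun s : ℝ => g (v (z + shift i s))) (fderiv ℝ g (v z) (pderiv i v z)) 0 := by
  have h : HasFDerivAt g (fderiv ℝ g (v z)) (v (z + shift i 0)) := by
    simpa [shift_zero] using (hg.differentiable one_ne_zero (v z)).hasFDerivAt
  exact h.comp_hasDerivAt (0 : ℝ) (hv.hasDerivAt_zero i z)

theorem IsC1.comp {v : SpaceTime d → E} (hv : IsC1 v) {g : E → E'} (hg : ContDiff ℝ 1 g) :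
    IsC1 fun z => g (v z) :=
  isC1_of_hasDerivAt _ (hg.continuous.comp hv.continuous) (hv.comp_hasDerivAt hg) fun i =>
    ((hg.continuous_fderiv one_ne_zero).comp hv.continuous).clm_apply (hv.continuous_pderiv i)

theorem IsC1.pderiv_comp {v : SpaceTime d → E} (hv : IsC1 v) {g : E → E'} (hg : ContDiff ℝ 1 g)
    (i : Option (Fin d)) (z : SpaceTime d) :
    pderiv i (fun z => g (v z)) z = fderiv ℝ g (v z) (pderiv i v z) :=
  (hv.comp_hasDerivAt hg i z).deriv

theorem IsC1.bilin_hasDerivAt (L : E →L[ℝ] E' →L[ℝ] E'') {f : SpaceTime d → E}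
    {g : SpaceTime d → E'} (hf : IsC1 f) (hg : IsC1 g) (i : Option (Fin d)) (z : SpaceTime d) :
    HasDerivAt (fun s : ℝ => L (f (z + shift i s)) (g (z + shift i s)))
      (L (pderiv i f z) (g z) + L (f z) (pderiv i g z)) 0 := by
  simpa [shift_zero, add_comm] using
    L.hasDerivAt_of_bilinear (fun _ => hf.hasDerivAt_zero i z) fun _ => hg.hasDerivAt_zero i z

theorem IsC1.bilin (L : E →L[ℝ] E' →L[ℝ] E'') {f : SpaceTime d → E} {g : SpaceTime d → E'}
    (hf : IsC1 f) (hg : IsC1 g) : IsC1 fun z => L (f z) (g z) :=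
  isC1_of_hasDerivAt _ (L.continuous₂.comp (hf.continuous.prodMk hg.continuous))
    (hf.bilin_hasDerivAt L hg) fun i =>
      (L.continuous₂.comp ((hf.continuous_pderiv i).prodMk hg.continuous)).add
        (L.continuous₂.comp (hf.continuous.prodMk (hg.continuous_pderiv i)))

theorem IsC1.pderiv_bilin (L : E →L[ℝ] E' →L[ℝ] E'') {f : SpaceTime d → E} {g : SpaceTime d → E'}
    (hf : IsC1 f) (hg : IsC1 g) (i : Option (Fin d)) (z : SpaceTime d) :
    pderiv i (fun z => L (f z) (g z)) z = L (pderiv i f z) (g z) + L (f z) (pderiv i g z) :=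
  (hf.bilin_hasDerivAt L hg i z).deriv

theorem isC1_comp_fst {φ : ℝ → ℝ} (hφ : ContDiff ℝ 1 φ) : IsC1 fun z : SpaceTime d => φ z.1 :=
  isC1_of_contDiff_cover (hφ.comp contDiff_fst)

theorem pderiv_none_comp_fst (φ : ℝ → ℝ) (z : SpaceTime d) :
    pderiv none (fun z : SpaceTime d => φ z.1) z = deriv φ z.1 := by
  simp [pderiv_none, dt]

theorem pderiv_some_comp_fst (φ : ℝ → ℝ) (α : Fin d) (z : SpaceTime d) :
    pderiv (some α) (fun z : SpaceTime d => φ z.1) z = 0 := by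
  simp [pderiv_some, dx]

-- The integral of `f` over space-time does not change under the displacement by `1`.
theorem IsC1.integral_pderiv_eq_zero [CompleteSpace E] {f : SpaceTime d → E} (hf : IsC1 f)
    (hf_int : Integrable f) {i : Option (Fin d)} (hf'_int : Integrable (pderiv i f)) :
    ∫ z, pderiv i f z = 0 := by
  have hcont : Continuous fun x : ℝ × SpaceTime d => pderiv i f (x.2 + shift i x.1) := by
    have := continuous_shift (d := d) i
    have := hf.continuous_pderiv i
    fun_prop
  have hint : Integrable (fun x : ℝ × SpaceTime d => pderiv i f (x.2 + shift i x.1))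
      ((volume.restrict (uIoc 0 1)).prod volume) := by
    have : IsFiniteMeasure (volume.restrict (uIoc (0 : ℝ) 1)) := ⟨by simp⟩
    rw [integrable_prod_iff hcont.aestronglyMeasurable]
    simp only [integral_add_right_eq_self fun z => ‖pderiv i f z‖]
    exact ⟨ae_of_all _ fun s => hf'_int.comp_add_right (shift i s), integrable_const _⟩
  have hftc : ∀ z, ∫ s in (0 : ℝ)..1, pderiv i f (z + shift i s) = f (z + shift i 1) - f z := by
    intro z
    have hcont_z : Continuous fun s => pderiv i f (z + shift i s) :=
      hcont.comp (continuous_id.prodMk continuous_const)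
    rw [intervalIntegral.integral_eq_sub_of_hasDerivAt (fun s _ => hf.hasDerivAt i z s)
      (hcont_z.intervalIntegrable 0 1), shift_zero, add_zero]
  calc ∫ z, pderiv i f z
      = ∫ s in (0 : ℝ)..1, ∫ z, pderiv i f (z + shift i s) := by
        simp [integral_add_right_eq_self (pderiv i f)]
    _ = ∫ z, ∫ s in (0 : ℝ)..1, pderiv i f (z + shift i s) :=
        intervalIntegral_integral_swap hint
    _ = 0 := by
        simp only [hftc]
        rw [integral_sub (hf_int.comp_add_right _) hf_int, integral_add_right_eq_self f, sub_self]

theorem IsC1.integral_bilin_pderiv [CompleteSpace E''] (L : E →L[ℝ] E' →L[ℝ] E'')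
    {f : SpaceTime d → E} {g : SpaceTime d → E'} (hf : IsC1 f) (hf_supp : HasCompactSupport f)
    (hg : IsC1 g) (i : Option (Fin d)) :
    ∫ z, L (pderiv i f z) (g z) = -∫ z, L (f z) (pderiv i g z) := by
  have hcompact : ∀ {f : SpaceTime d → E} (g : SpaceTime d → E'), HasCompactSupport f →
      HasCompactSupport fun z => L (f z) (g z) := fun g hf =>
    hf.mono fun z hz h => hz (by simp only [h, map_zero, zero_apply])
  have hint : Integrable fun z => L (pderiv i f z) (g z) :=
    (L.continuous₂.comp ((hf.continuous_pderiv i).prodMk hg.continuous)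
      ).integrable_of_hasCompactSupport (hcompact g (hasCompactSupport_pderiv hf_supp i))
  have hint' : Integrable fun z => L (f z) (pderiv i g z) :=
    (L.continuous₂.comp (hf.continuous.prodMk (hg.continuous_pderiv i))
      ).integrable_of_hasCompactSupport (hcompact (pderiv i g) hf_supp)
  have hzero := (hf.bilin L hg).integral_pderiv_eq_zero (i := i)
    ((hf.bilin L hg).continuous.integrable_of_hasCompactSupport (hcompact g hf_supp))
    (by
      simp only [funext (hf.pderiv_bilin L hg i)]
      exact hint.add hint')
  simp only [hf.pderiv_bilin L hg] at hzero
  rw [integral_add hint hint'] at hzero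
  exact eq_neg_of_add_eq_zero_left hzero

theorem IsC1.convolution_hasDerivAt {ρ : SpaceTime d → ℝ} (hρ : IsC1 ρ)
    (hρ_supp : HasCompactSupport ρ) {f : SpaceTime d → E} (hf : Integrable f)
    (i : Option (Fin d)) (z : SpaceTime d) :
    HasDerivAt (fun s => (ρ ⋆ f) (z + shift i s)) ((pderiv i ρ ⋆ f) z) 0 := by
  have hρ'_supp := hasCompactSupport_pderiv hρ_supp i
  have hexists : ∀ z, Integrable fun w => ρ (z - w) • f w := fun z =>
    (hρ_supp.convolutionExists_left (lsmul ℝ ℝ) hρ.continuous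
      hf.locallyIntegrable z).integrable_swap
  have hexists' : ∀ z, Integrable fun w => pderiv i ρ (z - w) • f w := fun z =>
    (hρ'_supp.convolutionExists_left (lsmul ℝ ℝ) (hρ.continuous_pderiv i)
      hf.locallyIntegrable z).integrable_swap
  obtain ⟨C, hC⟩ := hρ'_supp.exists_bound_of_continuous (hρ.continuous_pderiv i)
  have h := hasDerivAt_integral_of_dominated_loc_of_deriv_le (𝕜 := ℝ) (μ := volume) (x₀ := 0)
    (s := univ) (F := fun s w => ρ (z + shift i s - w) • f w)
    (F' := fun s w => pderiv i ρ (z + shift i s - w) • f w) (bound := fun w => C * ‖f w‖) univ_mem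
    (Eventually.of_forall fun s => (hexists _).aestronglyMeasurable) (hexists _)
    (hexists' _).aestronglyMeasurable
    (ae_of_all _ fun w s _ => by
      rw [norm_smul]; exact mul_le_mul_of_nonneg_right (hC _) (norm_nonneg _))
    (hf.norm.const_mul C)
    (ae_of_all _ fun w s _ => by
      simpa only [sub_add_eq_add_sub] using (hρ.hasDerivAt i (z - w) s).smul_const (f w))
  simpa only [convolution_lsmul_swap, shift_zero, add_zero] using h.2

theorem IsC1.convolution {ρ : SpaceTime d → ℝ} (hρ : IsC1 ρ) (hρ_supp : HasCompactSupport ρ)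
    {f : SpaceTime d → E} (hf : Integrable f) : IsC1 (ρ ⋆ f) :=
  isC1_of_hasDerivAt _
    (hρ_supp.continuous_convolution_left _ hρ.continuous hf.locallyIntegrable)
    (hρ.convolution_hasDerivAt hρ_supp hf) fun i =>
      (hasCompactSupport_pderiv hρ_supp i).continuous_convolution_left _
        (hρ.continuous_pderiv i) hf.locallyIntegrable

theorem IsC1.pderiv_convolution {ρ : SpaceTime d → ℝ} (hρ : IsC1 ρ) (hρ_supp : HasCompactSupport ρ)
    {f : SpaceTime d → E} (hf : Integrable f) (i : Option (Fin d)) :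
    pderiv i (ρ ⋆ f) = pderiv i ρ ⋆ f :=
  funext fun z => (hρ.convolution_hasDerivAt hρ_supp hf i z).deriv

end SpaceTime

/-! ### Mollification on space-time -/

section Mollifier

open ContinuousLinearMap Function

/-- The cosine on the circle `ℝ / 2πℤ`. -/
def circleCos : AddCircle (2 * Real.pi) → ℝ := Real.cos_periodic.lift

theorem circleCos_coe (x : ℝ) : circleCos (x : AddCircle (2 * Real.pi)) = Real.cos x :=
  Real.cos_periodic.lift_coe x

theorem circleCos_le_one (x : AddCircle (2 * Real.pi)) : circleCos x ≤ 1 := by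
  obtain ⟨r, rfl⟩ := QuotientAddGroup.mk_surjective x
  exact (circleCos_coe r).trans_le (Real.cos_le_one r)

theorem circleCos_eq_one_iff {x : AddCircle (2 * Real.pi)} : circleCos x = 1 ↔ x = 0 := by
  obtain ⟨r, rfl⟩ := QuotientAddGroup.mk_surjective x
  have hcos := Real.cos_eq_one_iff r
  rw [← circleCos_coe] at hcos
  exact hcos.trans (by simpa using (AddCircle.coe_eq_zero_iff (2 * Real.pi) (x := r)).symm)

variable {d : ℕ}

/-- A smooth function on space-time that vanishes at the origin only, used to localize the
mollifiers. -/
def spread (z : SpaceTime d) : ℝ := z.1 ^ 2 + ∑ i, (1 - circleCos (z.2 i))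

theorem contDiff_spread_cover : ContDiff ℝ ∞ fun y => spread (cover y : SpaceTime d) := by
  simp only [spread, cover, toTorus, circleCos_coe]
  fun_prop

theorem continuous_spread : Continuous (spread : SpaceTime d → ℝ) :=
  isOpenQuotientMap_cover.isQuotientMap.continuous_iff.2 contDiff_spread_cover.continuous

theorem sum_one_sub_circleCos_nonneg (x : Torus d) : 0 ≤ ∑ i, (1 - circleCos (x i)) :=
  Finset.sum_nonneg fun _ _ => sub_nonneg.2 (circleCos_le_one _)

theorem sq_fst_le_spread (z : SpaceTime d) : z.1 ^ 2 ≤ spread z :=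
  le_add_of_nonneg_right (sum_one_sub_circleCos_nonneg z.2)

theorem spread_nonneg (z : SpaceTime d) : 0 ≤ spread z :=
  (sq_nonneg z.1).trans (sq_fst_le_spread z)

theorem spread_eq_zero_iff {z : SpaceTime d} : spread z = 0 ↔ z = 0 := by
  rw [spread, add_eq_zero_iff_of_nonneg (sq_nonneg _) (sum_one_sub_circleCos_nonneg z.2),
    Finset.sum_eq_zero_iff_of_nonneg fun i _ => sub_nonneg.2 (circleCos_le_one _)]
  simp [sub_eq_zero, eq_comm (a := (1 : ℝ)), circleCos_eq_one_iff, Prod.ext_iff, funext_iff]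

theorem mem_slab_of_spread_le_one {z : SpaceTime d} (hz : spread z ≤ 1) : z ∈ slab d (-1) 1 :=
  mem_slab.2 (abs_le.1 (sq_le_one_iff_abs_le_one _ |>.1 ((sq_fst_le_spread z).trans hz)))

theorem exists_spread_lt_subset {U : Set (SpaceTime d)} (hU : U ∈ 𝓝 0) :
    ∃ δ > 0, {z | spread z < δ} ⊆ U := by
  have hK : IsCompact (slab d (-1) 1 \ interior U) := (isCompact_slab _ _).diff isOpen_interior
  obtain ⟨m, hm, hle⟩ := hK.exists_forall_le' (a := 0) continuous_spread.continuousOn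
    fun z hz => (spread_nonneg z).lt_of_ne fun h => hz.2 <|
      spread_eq_zero_iff.1 h.symm ▸ mem_interior_iff_mem_nhds.2 hU
  refine ⟨min 1 m, lt_min one_pos hm, fun z hz => ?_⟩
  by_contra hzU
  have hz' := lt_min_iff.1 (Set.mem_ofPred.1 hz)
  exact (hle z ⟨mem_slab_of_spread_le_one hz'.1.le, fun h => hzU (interior_subset h)⟩).not_gt hz'.2

/-- A smooth nonnegative function on space-time, positive where `spread z < 1 / (k + 1)` and zero
elsewhere. -/
def bump (k : ℕ) (z : SpaceTime d) : ℝ := Real.smoothTransition (1 - spread z * (k + 1))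

theorem contDiff_bump_cover (k : ℕ) : ContDiff ℝ ∞ fun y => bump k (cover y : SpaceTime d) :=
  Real.smoothTransition.contDiff.comp
    (contDiff_const.sub (contDiff_spread_cover.mul contDiff_const))

theorem continuous_bump (k : ℕ) : Continuous (bump k : SpaceTime d → ℝ) :=
  isOpenQuotientMap_cover.isQuotientMap.continuous_iff.2 (contDiff_bump_cover k).continuous

theorem bump_nonneg (k : ℕ) (z : SpaceTime d) : 0 ≤ bump k z := Real.smoothTransition.nonneg _

theorem spread_lt_of_bump_ne_zero {k : ℕ} {z : SpaceTime d} (hz : bump k z ≠ 0) :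
    spread z < 1 / ((k : ℝ) + 1) := by
  by_contra! h
  rw [div_le_iff₀ (by positivity)] at h
  exact hz (Real.smoothTransition.zero_of_nonpos (by linarith))

theorem hasCompactSupport_bump (k : ℕ) : HasCompactSupport (bump k : SpaceTime d → ℝ) :=
  hasCompactSupport_of_support_subset_slab fun _ hz => mem_slab_of_spread_le_one <|
    (spread_lt_of_bump_ne_zero hz).le.trans <|
      div_le_one_of_le₀ (by linarith [k.cast_nonneg (α := ℝ)]) (by positivity)

theorem integral_bump_pos (k : ℕ) : 0 < ∫ z : SpaceTime d, bump k z :=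
  (continuous_bump k).integral_pos_of_hasCompactSupport_nonneg_nonzero
    (hasCompactSupport_bump k) (bump_nonneg k) (x := 0)
    (by simp [bump, spread_eq_zero_iff.2])

/-- A sequence of smooth mollifiers on space-time. -/
def mollifier (k : ℕ) (z : SpaceTime d) : ℝ := (∫ w : SpaceTime d, bump k w)⁻¹ * bump k z

theorem contDiff_mollifier_cover (k : ℕ) :
    ContDiff ℝ ∞ fun y => mollifier k (cover y : SpaceTime d) :=
  contDiff_const.mul (contDiff_bump_cover k)

theorem isC1_mollifier (k : ℕ) : IsC1 (mollifier k : SpaceTime d → ℝ) :=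
  isC1_of_contDiff_cover ((contDiff_mollifier_cover k).of_le (by exact_mod_cast le_top))

theorem mollifier_nonneg (k : ℕ) (z : SpaceTime d) : 0 ≤ mollifier k z :=
  mul_nonneg (inv_nonneg.2 (integral_bump_pos k).le) (bump_nonneg k z)

theorem hasCompactSupport_mollifier (k : ℕ) : HasCompactSupport (mollifier k : SpaceTime d → ℝ) :=
  (hasCompactSupport_bump k).mul_left

theorem integrable_mollifier (k : ℕ) : Integrable (mollifier k : SpaceTime d → ℝ) :=
  (isC1_mollifier k).continuous.integrable_of_hasCompactSupport (hasCompactSupport_mollifier k)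

theorem integral_mollifier (k : ℕ) : ∫ z : SpaceTime d, mollifier k z = 1 := by
  simp only [mollifier]
  rw [integral_const_mul, inv_mul_cancel₀ (integral_bump_pos k).ne']

theorem tendsto_support_mollifier :
    Tendsto (fun k => support (mollifier k : SpaceTime d → ℝ)) atTop (𝓝 0).smallSets := by
  refine tendsto_smallSets_iff.2 fun U hU => ?_
  obtain ⟨δ, hδ, hδU⟩ := exists_spread_lt_subset hU
  filter_upwards [tendsto_one_div_add_atTop_nhds_zero_nat.eventually (gt_mem_nhds hδ)]
    with k hk z hz
  exact hδU ((spread_lt_of_bump_ne_zero (right_ne_zero_of_mul hz)).trans hk)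

variable {E : Type*} [NormedAddCommGroup E] [NormedSpace ℝ E]

theorem norm_mollifier_convolution_le (k : ℕ) {f : SpaceTime d → E} {M : ℝ}
    (hM : ∀ᵐ w, ‖f w‖ ≤ M) (z : SpaceTime d) : ‖(mollifier k ⋆ f) z‖ ≤ M := by
  have hbound : ∀ᵐ w, ‖mollifier k (z - w) • f w‖ ≤ mollifier k (z - w) * M := by
    filter_upwards [hM] with w hw
    rw [norm_smul, Real.norm_of_nonneg (mollifier_nonneg _ _)]
    exact mul_le_mul_of_nonneg_left hw (mollifier_nonneg _ _)
  calc ‖(mollifier k ⋆ f) z‖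
      ≤ ∫ w, mollifier k (z - w) * M := by
        rw [convolution_lsmul_swap]
        exact norm_integral_le_of_norm_le
          (((integrable_mollifier k).comp_sub_left z).mul_const M) hbound
    _ = M := by
        rw [integral_mul_const, integral_sub_left_eq_self (mollifier k) volume z,
          integral_mollifier, one_mul]

theorem exists_subseq_mollifier_convolution_tendsto_ae [CompleteSpace E] {f : SpaceTime d → E}
    (hf : Integrable f) :
    ∃ ns : ℕ → ℕ, StrictMono ns ∧
      ∀ᵐ z, Tendsto (fun k => (mollifier (ns k) ⋆ f) z) atTop (𝓝 (f z)) :=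
  (tendstoInMeasure_of_tendsto_eLpNorm one_ne_zero
    (fun k => (hf.integrable_convolution (lsmul ℝ ℝ).flip (integrable_mollifier k)
      |>.aestronglyMeasurable.congr (by rw [convolution_flip]))) hf.aestronglyMeasurable
    (tendsto_eLpNorm_one_convolution_sub mollifier_nonneg integrable_mollifier integral_mollifier
      tendsto_support_mollifier hf)).exists_seq_tendsto_ae

end Mollifier

section WeakEquation

open ContinuousLinearMap Function

variable {d : ℕ} {T a b : ℝ}

theorem measurableSet_cyl : MeasurableSet (cyl d T) := measurableSet_Ico.prod MeasurableSet.univ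

theorem slab_subset_cyl (ha : 0 < a) (hb : b < T) : slab d a b ⊆ cyl d T :=
  prod_mono (fun _ h => ⟨ha.le.trans h.1, h.2.trans_lt hb⟩) subset_rfl

theorem slab_subset_openCyl (ha : 0 < a) (hb : b < T) : slab d a b ⊆ openCyl d T :=
  prod_mono (fun _ h => ⟨ha.trans_le h.1, h.2.trans_lt hb⟩) subset_rfl

theorem integrableOn_slab {E : Type*} [NormedAddCommGroup E] {f : SpaceTime d → E}
    (hf : LocallyIntegrableOn f (openCyl d T)) (ha : 0 < a) (hb : b < T) :
    IntegrableOn f (slab d a b) :=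
  hf.integrableOn_compact_subset (slab_subset_openCyl ha hb) (isCompact_slab a b)

variable {E : Type*} [NormedAddCommGroup E] [NormedSpace ℝ E]

theorem setIntegral_slab_eq_integral {f : SpaceTime d → E} (hf : support f ⊆ slab d a b) :
    ∫ z in slab d a b, f z = ∫ z, f z :=
  setIntegral_eq_integral_of_forall_compl_eq_zero fun _ => support_subset_iff'.1 hf _

theorem setIntegral_cyl_eq_slab (ha : 0 < a) (hb : b < T) {f : SpaceTime d → E}
    (hf : support f ⊆ slab d a b) : ∫ z in cyl d T, f z = ∫ z in slab d a b, f z := by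
  rw [setIntegral_slab_eq_integral hf]
  exact setIntegral_eq_integral_of_forall_compl_eq_zero fun _ hz =>
    support_subset_iff'.1 hf _ fun hz' => hz (slab_subset_cyl ha hb hz')

theorem IsTest.exists_support_subset_slab {φ : SpaceTime d → ℝ} (hφ : IsTest T φ) :
    ∃ a b, 0 < a ∧ b < T ∧ support φ ⊆ slab d a b := by
  obtain ⟨a, b, ha, hb, h⟩ := hφ.supp
  exact ⟨a, b, ha, hb, support_subset_iff'.2 fun z hz => h z fun hz' => hz (mem_slab.2 hz')⟩

theorem isTest_mollifier_sub {k : ℕ} {z : SpaceTime d} (ha : 0 < a) (hb : b < T)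
    (h : support (fun w => mollifier k (z - w)) ⊆ slab d a b) :
    IsTest T fun w => mollifier k (z - w) := by
  refine ⟨?_, a, b, ha, hb, fun w hw => notMem_support.1 fun hw' => hw (mem_slab.1 (h hw'))⟩
  obtain ⟨y, rfl⟩ := isOpenQuotientMap_cover.surjective z
  have hcover : ∀ x, cover (y - x) = (cover y - cover x : SpaceTime d) := fun x =>
    eq_sub_of_add_eq (by rw [← cover_add, sub_add_cancel])
  have h := (contDiff_mollifier_cover (d := d) k).comp (contDiff_const (c := y).sub contDiff_id)
  simp only [comp_def, id, hcover] at h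
  exact h

theorem eventually_support_mollifier_sub_subset {ε : ℝ} (hε : 0 < ε) :
    ∀ᶠ k : ℕ in atTop, ∀ z ∈ slab d a b,
      support (fun w => mollifier k (z - w)) ⊆ slab d (a - ε) (b + ε) := by
  have hnhds : slab d (-ε) ε ∈ 𝓝 0 :=
    prod_mem_nhds (Icc_mem_nhds (neg_lt_zero.2 hε) hε) univ_mem
  filter_upwards [tendsto_smallSets_iff.1 tendsto_support_mollifier _ hnhds] with k hk z hz w hw
  have hz' := mem_slab.1 hz
  have hw' := mem_slab.1 (hk hw)
  simp only [Prod.fst_sub, mem_Icc] at hz' hw'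
  exact mem_slab.2 ⟨by linarith, by linarith⟩

theorem pderiv_comp_const_sub (f : SpaceTime d → E) (i : Option (Fin d)) (z w : SpaceTime d) :
    pderiv i (fun w => f (z - w)) w = -pderiv i f (z - w) := by
  have hneg : ∀ s, (shift i (-s) : SpaceTime d) = -shift i s := fun s =>
    eq_neg_of_add_eq_zero_left (by rw [← shift_add, neg_add_cancel, shift_zero])
  have h := deriv_comp_neg (f := fun s => f (z - w + shift i s)) 0
  simpa only [pderiv, hneg, ← sub_eq_add_neg, sub_sub, neg_zero] using h

theorem convolution_indicator_apply {S : Set (SpaceTime d)} (hS : MeasurableSet S)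
    (ρ : SpaceTime d → ℝ) (f : SpaceTime d → E) (z : SpaceTime d) :
    (ρ ⋆ S.indicator f) z = ∫ w in S, ρ (z - w) • f w := by
  rw [convolution_lsmul_swap, ← integral_indicator hS]
  exact integral_congr_ae <| ae_of_all _ fun w =>
    (indicator_smul_apply S (fun w => ρ (z - w)) f w).symm

theorem pderiv_mollifier_convolution_indicator {S : Set (SpaceTime d)} (hS : MeasurableSet S)
    {f : SpaceTime d → E} (hf : IntegrableOn f S) (k : ℕ) (i : Option (Fin d)) (z : SpaceTime d) :
    pderiv i (mollifier k ⋆ S.indicator f) z =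
      -∫ w in S, pderiv i (fun w => mollifier k (z - w)) w • f w := by
  rw [(isC1_mollifier k).pderiv_convolution (hasCompactSupport_mollifier k)
    (hf.integrable_indicator hS), convolution_indicator_apply hS, ← integral_neg]
  simp only [pderiv_comp_const_sub, neg_smul, neg_neg]

theorem sum_pderiv_mollifier_convolution_eq_zero {B : Option (Fin d) → SpaceTime d → E}
    (hB : ∀ i, LocallyIntegrableOn (B i) (openCyl d T))
    (hB_eq : ∀ φ, IsTest T φ → ∑ i, ∫ z in cyl d T, pderiv i φ z • B i z = 0)
    (ha : 0 < a) (hb : b < T) {k : ℕ} {z : SpaceTime d}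
    (h : support (fun w => mollifier k (z - w)) ⊆ slab d a b) :
    ∑ i, pderiv i (mollifier k ⋆ (slab d a b).indicator (B i)) z = 0 := by
  simp only [pderiv_mollifier_convolution_indicator (measurableSet_slab a b)
    (integrableOn_slab (hB _) ha hb)]
  rw [Finset.sum_neg_distrib, neg_eq_zero, ← hB_eq _ (isTest_mollifier_sub ha hb h)]
  exact Finset.sum_congr rfl fun i _ => (setIntegral_cyl_eq_slab ha hb
    ((support_smul_subset_left _ _).trans (support_pderiv_subset_slab h i))).symm

end WeakEquation

section WeakEquationInner

open ContinuousLinearMap Function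

variable {d : ℕ} {T a b : ℝ} {E : Type*} [NormedAddCommGroup E] [InnerProductSpace ℝ E]

theorem sum_integral_inner_pderiv_eq_zero_of_isC1 {B : Option (Fin d) → SpaceTime d → E}
    (hB : ∀ i, IsC1 (B i)) (hB_eq : ∀ z ∈ slab d a b, ∑ i, pderiv i (B i) z = 0)
    {Ψ : SpaceTime d → E} (hΨ : IsC1 Ψ) (hΨ_supp : support Ψ ⊆ slab d a b) :
    ∑ i, ∫ z, inner ℝ (pderiv i Ψ z) (B i z) = 0 := by
  have hΨ_compact := hasCompactSupport_of_support_subset_slab hΨ_supp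
  calc ∑ i, ∫ z, inner ℝ (pderiv i Ψ z) (B i z)
      = ∑ i, -∫ z, inner ℝ (Ψ z) (pderiv i (B i) z) :=
        Finset.sum_congr rfl fun i _ =>
          hΨ.integral_bilin_pderiv (innerSL ℝ) hΨ_compact (hB i) i
    _ = -∫ z, inner ℝ (Ψ z) (∑ i, pderiv i (B i) z) := by
        simp only [inner_sum]
        rw [Finset.sum_neg_distrib, integral_finsetSum]
        exact fun i _ => (hΨ.continuous.inner ((hB i).continuous_pderiv i)
          ).integrable_of_hasCompactSupport (hΨ_compact.mono fun z hz h => hz (by simp [h]))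
    _ = 0 := by
        refine neg_eq_zero.2 (integral_eq_zero_of_ae (ae_of_all _ fun z => ?_))
        by_cases hz : z ∈ slab d a b
        · simp [hB_eq z hz]
        · simp [support_subset_iff'.1 hΨ_supp z hz]

variable [CompleteSpace E]

theorem tendsto_integral_inner_mollifier_convolution {f g : SpaceTime d → E} (hf : Integrable f)
    (hg : AEStronglyMeasurable g) {C : ℝ} (hC : ∀ z, ‖g z‖ ≤ C) :
    Tendsto (fun k => ∫ z, inner ℝ (g z) ((mollifier k ⋆ f) z)) atTop
      (𝓝 (∫ z, inner ℝ (g z) (f z))) := by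
  have hmoll : ∀ k, Integrable (mollifier k ⋆ f) := fun k =>
    (integrable_mollifier k).integrable_convolution (lsmul ℝ ℝ) hf
  have hinner : ∀ {h : SpaceTime d → E}, Integrable h → Integrable fun z => inner ℝ (g z) (h z) :=
    fun hh => hh.norm.const_mul C |>.mono' (hg.inner hh.aestronglyMeasurable) <|
      ae_of_all _ fun z => (norm_inner_le_norm _ _).trans <| by gcongr; exact hC z
  refine tendsto_integral_of_L1' _ (hinner hf).aestronglyMeasurable
    (Eventually.of_forall fun k => hinner (hmoll k)) ?_
  have hlim := ENNReal.Tendsto.const_mul (a := ENNReal.ofReal C)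
    (tendsto_eLpNorm_one_convolution_sub mollifier_nonneg integrable_mollifier integral_mollifier
      tendsto_support_mollifier hf) (.inr ENNReal.ofReal_ne_top)
  rw [mul_zero] at hlim
  refine tendsto_of_tendsto_of_tendsto_of_le_of_le tendsto_const_nhds hlim (fun _ => zero_le) ?_
  refine fun k => eLpNorm_le_mul_eLpNorm_of_ae_le_mul (ae_of_all _ fun z => ?_) 1
  simp only [Pi.sub_apply, ← inner_sub_right]
  exact (norm_inner_le_norm _ _).trans (by gcongr; exact hC z)

theorem exists_pos_sub_pos_add_lt (ha : 0 < a) (hb : b < T) : ∃ ε > 0, 0 < a - ε ∧ b + ε < T :=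
  ⟨min a (T - b) / 2, by have := lt_min ha (sub_pos.2 hb); linarith,
    by linarith [min_le_left a (T - b)], by linarith [min_le_right a (T - b)]⟩

theorem sum_integral_inner_pderiv_eq_zero {B : Option (Fin d) → SpaceTime d → E}
    (hB : ∀ i, LocallyIntegrableOn (B i) (openCyl d T))
    (hB_eq : ∀ φ, IsTest T φ → ∑ i, ∫ z in cyl d T, pderiv i φ z • B i z = 0)
    (ha : 0 < a) (hb : b < T) {Ψ : SpaceTime d → E} (hΨ : IsC1 Ψ)
    (hΨ_supp : support Ψ ⊆ slab d a b) :
    ∑ i, ∫ z in slab d a b, inner ℝ (pderiv i Ψ z) (B i z) = 0 := by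
  obtain ⟨ε, hε, hεa, hεb⟩ := exists_pos_sub_pos_add_lt ha hb
  set S := slab d (a - ε) (b + ε)
  have hS : MeasurableSet S := measurableSet_slab _ _
  have hBS : ∀ i, IntegrableOn (B i) S := fun i => integrableOn_slab (hB i) hεa hεb
  have hB_int : ∀ i, Integrable (S.indicator (B i)) := fun i => (hBS i).integrable_indicator hS
  have hmoll : ∀ᶠ k : ℕ in atTop,
      ∑ i, ∫ z, inner ℝ (pderiv i Ψ z) ((mollifier k ⋆ S.indicator (B i)) z) = 0 := by
    filter_upwards [eventually_support_mollifier_sub_subset (d := d) (a := a) (b := b) hε] with k hk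
    exact sum_integral_inner_pderiv_eq_zero_of_isC1
      (fun i => (isC1_mollifier k).convolution (hasCompactSupport_mollifier k) (hB_int i))
      (fun z hz => sum_pderiv_mollifier_convolution_eq_zero hB hB_eq hεa hεb (hk z hz)) hΨ hΨ_supp
  have hlim : Tendsto
      (fun k => ∑ i, ∫ z, inner ℝ (pderiv i Ψ z) ((mollifier k ⋆ S.indicator (B i)) z)) atTop
      (𝓝 (∑ i, ∫ z, inner ℝ (pderiv i Ψ z) (S.indicator (B i) z))) := by
    refine tendsto_finsetSum _ fun i _ => ?_
    obtain ⟨C, hC⟩ := (hasCompactSupport_of_support_subset_slab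
      (support_pderiv_subset_slab hΨ_supp i)).exists_bound_of_continuous (hΨ.continuous_pderiv i)
    exact tendsto_integral_inner_mollifier_convolution (hB_int i)
      (hΨ.continuous_pderiv i).aestronglyMeasurable hC
  rw [← tendsto_nhds_unique hlim (tendsto_const_nhds.congr' (hmoll.mono fun _ h => h.symm))]
  refine Finset.sum_congr rfl fun i _ => ?_
  have hsub : slab d a b ⊆ S := fun z hz => mem_slab.2
    ⟨by linarith [(mem_slab.1 hz).1], by linarith [(mem_slab.1 hz).2]⟩
  have hsupp : support (fun z => inner ℝ (pderiv i Ψ z) (S.indicator (B i) z)) ⊆ slab d a b :=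
    fun z hz => support_pderiv_subset_slab hΨ_supp i fun h => hz (by simp only [h, inner_zero_left])
  rw [← setIntegral_slab_eq_integral hsupp]
  exact setIntegral_congr_fun (measurableSet_slab a b) fun z hz => by
    simp only [indicator_of_mem (hsub hz)]

end WeakEquationInner

/-! ### Bounded functions with bounded weak derivatives -/

section BoundedComposition

variable {X P : Type*} [MeasurableSpace X] {μ : Measure X} [NormedAddCommGroup P]

theorem memLp_top_iff_exists_ae_norm_le {f : X → P} :
    MemLp f ⊤ μ ↔ AEStronglyMeasurable f μ ∧ ∃ M, ∀ᵐ x ∂μ, ‖f x‖ ≤ M :=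
  ⟨fun hf => ⟨hf.aestronglyMeasurable, _, ae_le_lpNorm_exponent_top hf⟩,
    fun ⟨hf, M, hM⟩ => memLp_top_of_bound hf M hM⟩

variable [ProperSpace P] {F : Type*} [NormedAddCommGroup F] {Φ : P → F}

theorem exists_norm_comp_le_of_continuous (hΦ : Continuous Φ) (M : ℝ) :
    ∃ C, ∀ x, ‖x‖ ≤ M → ‖Φ x‖ ≤ C := by
  obtain ⟨C, hC⟩ :=
    (isCompact_closedBall (0 : P) M).exists_bound_of_continuousOn hΦ.continuousOn
  exact ⟨C, fun x hx => hC x (mem_closedBall_zero_iff.2 hx)⟩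

theorem memLp_top_comp_of_continuous (hΦ : Continuous Φ) {f : X → P} (hf : MemLp f ⊤ μ) :
    MemLp (fun x => Φ (f x)) ⊤ μ := by
  obtain ⟨hmeas, M, hM⟩ := memLp_top_iff_exists_ae_norm_le.1 hf
  obtain ⟨C, hC⟩ := exists_norm_comp_le_of_continuous hΦ M
  exact memLp_top_of_bound (hΦ.comp_aestronglyMeasurable hmeas) C (hM.mono fun x => hC _)

variable {H K : Type*} [NormedAddCommGroup H] [NormedSpace ℝ H] [NormedSpace ℝ F]
  [NormedAddCommGroup K] [NormedSpace ℝ K]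

theorem integrable_bilin_of_memLp_top (L : H →L[ℝ] F →L[ℝ] K) {c : X → H}
    (hc : Integrable c μ) {f : X → F} (hf : MemLp f ⊤ μ) : Integrable (fun x => L (c x) (f x)) μ :=
  memLp_one_iff_integrable.1 (L.memLp_of_bilin 1 (memLp_one_iff_integrable.2 hc) hf)

theorem tendsto_integral_bilin_comp (L : H →L[ℝ] F →L[ℝ] K) (hΦ : Continuous Φ) {c : X → H}
    (hc : Integrable c μ) {f : ℕ → X → P} {f_lim : X → P}
    (hf : ∀ k, AEStronglyMeasurable (f k) μ) {M : ℝ} (hM : ∀ k, ∀ᵐ x ∂μ, ‖f k x‖ ≤ M)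
    (hlim : ∀ᵐ x ∂μ, Tendsto (fun k => f k x) atTop (𝓝 (f_lim x))) :
    Tendsto (fun k => ∫ x, L (c x) (Φ (f k x)) ∂μ) atTop (𝓝 (∫ x, L (c x) (Φ (f_lim x)) ∂μ)) := by
  obtain ⟨C, hC⟩ := exists_norm_comp_le_of_continuous hΦ M
  refine tendsto_integral_of_dominated_convergence (fun x => ‖L‖ * ‖c x‖ * C)
    (fun k => L.aestronglyMeasurable_comp₂ hc.aestronglyMeasurable
      (hΦ.comp_aestronglyMeasurable (hf k)))
    ((hc.norm.const_mul _).mul_const _) (fun k => ?_) ?_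
  · filter_upwards [hM k] with x hx
    exact (L.le_opNorm₂ _ _).trans (by gcongr; exact hC _ hx)
  · filter_upwards [hlim] with x hx
    exact ((L (c x)).continuous.comp hΦ).continuousAt.tendsto.comp hx

end BoundedComposition

section WeakGradient

open ContinuousLinearMap Function

variable {d : ℕ} {T a b : ℝ} {E E' : Type*} [NormedAddCommGroup E] [NormedSpace ℝ E]
  [NormedAddCommGroup E'] [NormedSpace ℝ E']

/-- `v` belongs to `W^{1,∞}((0,T) × 𝕋ᵈ)` and `w i` is its weak derivative in the `i`-th coordinate
direction. -/
structure HasWeakGrad (T : ℝ) (v : SpaceTime d → E) (w : Option (Fin d) → SpaceTime d → E) :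
    Prop where
  memLp : MemLp v ⊤ (volume.restrict (cyl d T))
  memLp_grad : ∀ i, MemLp (w i) ⊤ (volume.restrict (cyl d T))
  integral_eq : ∀ i φ, IsTest T φ →
    ∫ z in cyl d T, pderiv i φ z • v z = -∫ z in cyl d T, φ z • w i z

instance : IsFiniteMeasure (volume.restrict (cyl d T)) :=
  ⟨by
    rw [Measure.restrict_apply_univ]
    exact (measure_mono (prod_mono Ico_subset_Icc_self subset_rfl)).trans_lt
      (volume_slab_ne_top 0 T).lt_top⟩

variable {v : SpaceTime d → E} {w : Option (Fin d) → SpaceTime d → E}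

theorem HasWeakGrad.pderiv_mollifier_convolution (h : HasWeakGrad T v w) (ha : 0 < a) (hb : b < T)
    {k : ℕ} {z : SpaceTime d} (hz : support (fun w => mollifier k (z - w)) ⊆ slab d a b)
    (i : Option (Fin d)) :
    pderiv i (mollifier k ⋆ (cyl d T).indicator v) z =
      (mollifier k ⋆ (cyl d T).indicator (w i)) z := by
  rw [pderiv_mollifier_convolution_indicator measurableSet_cyl (h.memLp.integrable le_top),
    h.integral_eq i _ (isTest_mollifier_sub ha hb hz), neg_neg,
    convolution_indicator_apply measurableSet_cyl]

theorem HasWeakGrad.memLp_prodMk (h : HasWeakGrad T v w) :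
    MemLp (fun z => (v z, fun i => w i z)) ⊤ (volume.restrict (cyl d T)) :=
  .of_fst_snd ⟨h.memLp, .of_eval h.memLp_grad⟩

theorem HasWeakGrad.eventually_mollifier_convolution_eq [CompleteSpace E] (h : HasWeakGrad T v w)
    (ha : 0 < a) (hb : b < T) :
    ∀ᶠ k : ℕ in atTop, ∀ z ∈ slab d a b,
      (mollifier k ⋆ (cyl d T).indicator fun z => (v z, fun i => w i z)) z =
        ((mollifier k ⋆ (cyl d T).indicator v) z,
          fun i => pderiv i (mollifier k ⋆ (cyl d T).indicator v) z) := by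
  obtain ⟨ε, hε, hεa, hεb⟩ := exists_pos_sub_pos_add_lt ha hb
  filter_upwards [eventually_support_mollifier_sub_subset (d := d) (a := a) (b := b) hε]
    with k hk z hz
  have hint : Integrable (fun x => mollifier k (z - x) • (v x, fun i => w i x))
      (volume.restrict (cyl d T)) := by
    obtain ⟨C, hC⟩ := (hasCompactSupport_mollifier (d := d) k).exists_bound_of_continuous
      (isC1_mollifier k).continuous
    exact (h.memLp_prodMk.integrable le_top).bdd_smul C ((isC1_mollifier k).continuous.comp
      (by fun_prop)).aestronglyMeasurable (ae_of_all _ fun x => hC _)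
  simp only [h.pderiv_mollifier_convolution hεa hεb (hk z hz),
    convolution_indicator_apply measurableSet_cyl]
  refine Prod.ext (fst_integral hint) ((snd_integral hint).trans (funext fun i => ?_))
  exact eval_integral (fun i => hint.snd.eval i) i

theorem IsC1.continuous_prodMk_pderiv {f : SpaceTime d → E} (hf : IsC1 f) :
    Continuous fun z => (f z, fun i => pderiv i f z) :=
  hf.continuous.prodMk (continuous_pi hf.continuous_pderiv)

theorem HasWeakGrad.exists_isC1_approx [CompleteSpace E] (h : HasWeakGrad T v w) (ha : 0 < a)
    (hb : b < T) :
    ∃ (V : ℕ → SpaceTime d → E) (M : ℝ), (∀ k, IsC1 (V k)) ∧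
      (∀ k, ∀ᵐ z ∂volume.restrict (slab d a b), ‖(V k z, fun i => pderiv i (V k) z)‖ ≤ M) ∧
      ∀ᵐ z ∂volume.restrict (slab d a b),
        Tendsto (fun k => (V k z, fun i => pderiv i (V k) z)) atTop (𝓝 (v z, fun i => w i z)) := by
  set f := (cyl d T).indicator fun z => (v z, fun i => w i z)
  have hf_memLp : MemLp f ⊤ := (memLp_indicator_iff_restrict measurableSet_cyl).2 h.memLp_prodMk
  obtain ⟨-, M, hM⟩ := memLp_top_iff_exists_ae_norm_le.1 hf_memLp
  obtain ⟨ns, hns, hlim⟩ := exists_subseq_mollifier_convolution_tendsto_ae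
    (IntegrableOn.integrable_indicator (h.memLp_prodMk.integrable le_top) measurableSet_cyl)
  obtain ⟨N, hN⟩ := eventually_atTop.1
    (hns.tendsto_atTop.eventually (h.eventually_mollifier_convolution_eq ha hb))
  refine ⟨fun k => mollifier (ns (k + N)) ⋆ (cyl d T).indicator v, M, fun k => ?_,
    fun k => ae_restrict_of_forall_mem (measurableSet_slab a b) fun z hz => ?_, ?_⟩
  · exact (isC1_mollifier _).convolution (hasCompactSupport_mollifier _)
      (IntegrableOn.integrable_indicator (h.memLp.integrable le_top) measurableSet_cyl)
  · rw [← hN _ (Nat.le_add_left N k) z hz]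
    exact norm_mollifier_convolution_le _ hM z
  · filter_upwards [ae_restrict_mem (measurableSet_slab a b), ae_restrict_of_ae hlim]
      with z hz hlim_z
    simp only [← hN _ (Nat.le_add_left N _) z hz]
    have hfz : f z = (v z, fun i => w i z) := indicator_of_mem (slab_subset_cyl ha hb hz) _
    exact hfz ▸ hlim_z.comp (tendsto_add_atTop_nat N)

end WeakGradient

section WeakChainRule

open ContinuousLinearMap Function

variable {d : ℕ} {T a b : ℝ} {E E' : Type*} [NormedAddCommGroup E] [NormedSpace ℝ E]
  [FiniteDimensional ℝ E] [NormedAddCommGroup E'] [NormedSpace ℝ E'] [CompleteSpace E']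
  {v : SpaceTime d → E} {w : Option (Fin d) → SpaceTime d → E}

theorem HasWeakGrad.comp (h : HasWeakGrad T v w) {g : E → E'} (hg : ContDiff ℝ 1 g) :
    HasWeakGrad T (fun z => g (v z)) fun i z => fderiv ℝ g (v z) (w i z) := by
  have hg_fderiv (i : Option (Fin d)) :
      Continuous fun x : E × (Option (Fin d) → E) => fderiv ℝ g x.1 (x.2 i) :=
    ((hg.continuous_fderiv one_ne_zero).comp continuous_fst).clm_apply (by fun_prop)
  have := FiniteDimensional.proper ℝ E
  refine ⟨memLp_top_comp_of_continuous hg.continuous h.memLp,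
    fun i => memLp_top_comp_of_continuous (hg_fderiv i) h.memLp_prodMk, fun i φ hφ => ?_⟩
  obtain ⟨a, b, ha, hb, hφ_supp⟩ := hφ.exists_support_subset_slab
  obtain ⟨V, M, hV, hM, hlim⟩ := h.exists_isC1_approx ha hb
  have hmeas (k : ℕ) := (hV k).continuous_prodMk_pderiv.aestronglyMeasurable
    (μ := volume.restrict (slab d a b))
  have integrable_of_continuous {f : SpaceTime d → ℝ} (hf : Continuous f) :
      Integrable f (volume.restrict (slab d a b)) :=
    hf.continuousOn.integrableOn_compact (isCompact_slab a b)
  have supp_smul {χ : SpaceTime d → ℝ} (hχ : support χ ⊆ slab d a b) (f : SpaceTime d → E') :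
      support (fun z => χ z • f z) ⊆ slab d a b := (support_smul_subset_left _ _).trans hχ
  have hpφ_supp := support_pderiv_subset_slab hφ_supp i
  rw [setIntegral_cyl_eq_slab ha hb (supp_smul hpφ_supp _),
    setIntegral_cyl_eq_slab ha hb (supp_smul hφ_supp _)]
  refine tendsto_nhds_unique
    (tendsto_integral_bilin_comp (lsmul ℝ ℝ)
      (Φ := fun x : E × (Option (Fin d) → E) => g x.1) (hg.continuous.comp continuous_fst)
      (integrable_of_continuous (hφ.isC1.continuous_pderiv i)) hmeas hM hlim)
    ((tendsto_integral_bilin_comp (lsmul ℝ ℝ) (hg_fderiv i)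
      (integrable_of_continuous hφ.isC1.continuous) hmeas hM hlim).neg.congr fun k => ?_)
  have hparts := hφ.isC1.integral_bilin_pderiv (lsmul ℝ ℝ)
    (hasCompactSupport_of_support_subset_slab hφ_supp) ((hV k).comp hg) i
  simp only [lsmul_apply, (hV k).pderiv_comp hg] at hparts ⊢
  rw [setIntegral_slab_eq_integral (supp_smul hφ_supp _),
    setIntegral_slab_eq_integral (supp_smul hpφ_supp _), hparts]

theorem HasWeakGrad.sum_integral_pderiv_smul_comp (h : HasWeakGrad T v w)
    {f : Option (Fin d) → E → E'} (hf : ∀ i, ContDiff ℝ 1 (f i))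
    (hfw : ∀ᵐ z ∂volume.restrict (cyl d T), ∑ i, fderiv ℝ (f i) (v z) (w i z) = 0)
    {φ : SpaceTime d → ℝ} (hφ : IsTest T φ) :
    ∑ i, ∫ z in cyl d T, pderiv i φ z • f i (v z) = 0 := by
  obtain ⟨a, b, -, -, hφ_supp⟩ := hφ.exists_support_subset_slab
  obtain ⟨C, hC⟩ := (hasCompactSupport_of_support_subset_slab hφ_supp).exists_bound_of_continuous
    hφ.isC1.continuous
  have hint (i : Option (Fin d)) :
      Integrable (fun z => φ z • fderiv ℝ (f i) (v z) (w i z)) (volume.restrict (cyl d T)) :=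
    ((h.comp (hf i)).memLp_grad i |>.integrable le_top).bdd_smul C
      hφ.isC1.continuous.aestronglyMeasurable (ae_of_all _ hC)
  simp only [fun i => (h.comp (hf i)).integral_eq i φ hφ, Finset.sum_neg_distrib]
  rw [← integral_finsetSum _ fun i _ => hint i, neg_eq_zero]
  refine integral_eq_zero_of_ae (hfw.mono fun z hz => ?_)
  simp only [← Finset.smul_sum, hz, smul_zero, Pi.zero_apply]

end WeakChainRule

section WeakEquationWeakGrad

open Function

variable {d : ℕ} {T a b : ℝ} {E : Type*} [NormedAddCommGroup E] [InnerProductSpace ℝ E]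
  [FiniteDimensional ℝ E] {v : SpaceTime d → E} {w B : Option (Fin d) → SpaceTime d → E}

theorem HasWeakGrad.sum_integral_inner_eq_zero (h : HasWeakGrad T v w)
    (hB : ∀ i, LocallyIntegrableOn (B i) (openCyl d T))
    (hB_eq : ∀ φ, IsTest T φ → ∑ i, ∫ z in cyl d T, pderiv i φ z • B i z = 0)
    (ha : 0 < a) (hb : b < T) {ψ : SpaceTime d → ℝ} (hψ : IsC1 ψ)
    (hψ_supp : support ψ ⊆ slab d a b) :
    ∑ i, ∫ z in slab d a b,
      (pderiv i ψ z * inner ℝ (v z) (B i z) + ψ z * inner ℝ (w i z) (B i z)) = 0 := by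
  have := FiniteDimensional.proper ℝ E
  obtain ⟨V, M, hV, hM, hlim⟩ := h.exists_isC1_approx ha hb
  have hmeas (k : ℕ) := (hV k).continuous_prodMk_pderiv.aestronglyMeasurable
    (μ := volume.restrict (slab d a b))
  have hc (i : Option (Fin d)) : Integrable (fun z => (pderiv i ψ z • B i z, ψ z • B i z))
      (volume.restrict (slab d a b)) := by
    have hint {f : SpaceTime d → ℝ} (hf : Continuous f) :=
      (integrableOn_slab (hB i) ha hb).continuousOn_smul hf.continuousOn (isCompact_slab a b)
    exact (hint (hψ.continuous_pderiv i)).prodMk (hint hψ.continuous)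
  let L : E × E →L[ℝ] E × E →L[ℝ] ℝ :=
    (innerSL ℝ).flip.bilinearComp (.fst ℝ E E) (.fst ℝ E E) +
      (innerSL ℝ).flip.bilinearComp (.snd ℝ E E) (.snd ℝ E E)
  have htendsto (i : Option (Fin d)) := tendsto_integral_bilin_comp L
    (Φ := fun x : E × (Option (Fin d) → E) => (x.1, x.2 i)) (by fun_prop) (hc i) hmeas hM hlim
  have hL (i : Option (Fin d)) (z : SpaceTime d) (x y : E) :
      L (pderiv i ψ z • B i z, ψ z • B i z) (x, y) =
        pderiv i ψ z * inner ℝ x (B i z) + ψ z * inner ℝ y (B i z) := by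
    simp only [L, add_apply, ContinuousLinearMap.bilinearComp_apply,
      ContinuousLinearMap.coe_fst', ContinuousLinearMap.coe_snd', ContinuousLinearMap.flip_apply,
      innerSL_apply_apply, real_inner_smul_right]
  simp only [hL] at htendsto
  refine tendsto_nhds_unique (tendsto_finsetSum _ fun i _ => htendsto i)
    (tendsto_const_nhds.congr fun k => ?_)
  have hpderiv (i : Option (Fin d)) (z : SpaceTime d) :
      pderiv i (fun z => ψ z • V k z) z = pderiv i ψ z • V k z + ψ z • pderiv i (V k) z :=
    hψ.pderiv_bilin (ContinuousLinearMap.lsmul ℝ ℝ) (hV k) i z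
  rw [← sum_integral_inner_pderiv_eq_zero hB hB_eq ha hb
    (hψ.bilin (ContinuousLinearMap.lsmul ℝ ℝ) (hV k))
    ((support_smul_subset_left _ _).trans hψ_supp)]
  simp only [ContinuousLinearMap.lsmul_apply, hpderiv, inner_add_left, real_inner_smul_left]

end WeakEquationWeakGrad

/-! ### Convexity in the conserved variables -/

section GlobalInverse

variable {E E' : Type*} [NormedAddCommGroup E] [NormedSpace ℝ E] [FiniteDimensional ℝ E]
  [NormedAddCommGroup E'] [NormedSpace ℝ E'] [CompleteSpace E']

-- The range is open by the inverse function theorem and closed by properness.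
theorem exists_contDiff_inverse_of_tendsto_cocompact {A : E → E'} {m : ℕ∞ω} (hA : ContDiff ℝ m A)
    (hm : m ≠ 0) (hA_inj : Function.Injective A)
    (hA_nonsing : ∀ u, Function.Bijective (fderiv ℝ A u))
    (hA_top : Tendsto A (cocompact E) (cocompact E')) :
    ∃ S : E' → E, ContDiff ℝ m S ∧ Function.LeftInverse S A ∧ Function.RightInverse S A := by
  have := FiniteDimensional.complete ℝ E
  have := FiniteDimensional.proper ℝ E
  let A' (u : E) : E ≃L[ℝ] E' := .ofBijective (fderiv ℝ A u)
    (LinearMap.ker_eq_bot.2 (hA_nonsing u).1) (LinearMap.range_eq_top.2 (hA_nonsing u).2)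
  have hA' (u : E) : HasStrictFDerivAt A (A' u : E →L[ℝ] E') u :=
    hA.contDiffAt.hasStrictFDerivAt hm
  have hopen : IsOpenMap A := isOpenMap_of_hasStrictFDerivAt_equiv hA'
  have hproper : IsProperMap A := isProperMap_iff_tendsto_cocompact.2 ⟨hA.continuous, hA_top⟩
  have hsurj : Function.Surjective A := range_eq_univ.1 <|
    IsClopen.eq_univ ⟨hproper.isClosedMap.isClosed_range, hopen.isOpen_range⟩ (range_nonempty A)
  let e : E ≃ₜ E' :=
    (Equiv.ofBijective A ⟨hA_inj, hsurj⟩).toHomeomorphOfContinuousOpen hA.continuous hopen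
  exact ⟨e.symm, e.contDiff_symm (fun u => (hA' u).hasFDerivAt) hA, e.symm_apply_apply,
    e.apply_symm_apply⟩

end GlobalInverse

section Multiplier

variable {E H : Type*} [NormedAddCommGroup E] [NormedSpace ℝ E] [NormedAddCommGroup H]
  [InnerProductSpace ℝ H] {A G : E → H} {η : E → ℝ}

theorem contDiff_two_of_fderiv_eq_inner (hA : ContDiff ℝ 2 A) (hG : ContDiff ℝ 1 G)
    (hη : Differentiable ℝ η) (h : ∀ u ξ, fderiv ℝ η u ξ = inner ℝ (G u) (fderiv ℝ A u ξ)) :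
    ContDiff ℝ 2 η := by
  rw [← one_add_one_eq_two, contDiff_succ_iff_fderiv]
  refine ⟨hη, by simp, ?_⟩
  have hη_eq : fderiv ℝ η = fun u => (innerSL ℝ (G u)).comp (fderiv ℝ A u) :=
    funext fun u => ContinuousLinearMap.ext (h u)
  exact hη_eq ▸ ((innerSL ℝ).contDiff.comp hG).clm_comp (hA.fderiv_right le_rfl)

theorem fderiv_fderiv_of_fderiv_eq_inner (hA : ContDiff ℝ 2 A) (hG : Differentiable ℝ G)
    (hη : ContDiff ℝ 2 η) (h : ∀ u ξ, fderiv ℝ η u ξ = inner ℝ (G u) (fderiv ℝ A u ξ))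
    (u ξ ζ : E) :
    fderiv ℝ (fderiv ℝ η) u ξ ζ =
      inner ℝ (G u) (fderiv ℝ (fderiv ℝ A) u ξ ζ) + inner ℝ (fderiv ℝ G u ξ) (fderiv ℝ A u ζ) := by
  have hη_fderiv := ((hη.fderiv_right le_rfl).differentiable one_ne_zero u).hasFDerivAt.clm_apply
    (hasFDerivAt_const ζ u)
  have hA_fderiv := ((hA.fderiv_right le_rfl).differentiable one_ne_zero u).hasFDerivAt.clm_apply
    (hasFDerivAt_const ζ u)
  simp only [h] at hη_fderiv
  simpa [fderivInnerCLM_apply] using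
    congr($(hη_fderiv.unique ((hG u).hasFDerivAt.inner ℝ hA_fderiv)) ξ)

theorem inner_fderiv_fderiv_comm (hA : ContDiff ℝ 2 A) (hG : ContDiff ℝ 1 G)
    (hη : Differentiable ℝ η) (h : ∀ u ξ, fderiv ℝ η u ξ = inner ℝ (G u) (fderiv ℝ A u ξ))
    (u ξ ζ : E) :
    inner ℝ (fderiv ℝ G u ξ) (fderiv ℝ A u ζ) = inner ℝ (fderiv ℝ G u ζ) (fderiv ℝ A u ξ) := by
  have hη₂ := contDiff_two_of_fderiv_eq_inner hA hG hη h
  have hG₁ := hG.differentiable one_ne_zero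
  have hη_symm := (hη₂.contDiffAt (x := u)).isSymmSndFDerivAt (by simp) ξ ζ
  rwa [fderiv_fderiv_of_fderiv_eq_inner hA hG₁ hη₂ h, fderiv_fderiv_of_fderiv_eq_inner hA hG₁ hη₂ h,
    (hA.contDiffAt (x := u)).isSymmSndFDerivAt (by simp) ξ ζ, add_right_inj] at hη_symm

end Multiplier

section StrongConvexity

theorem add_half_le_of_le_deriv2 {f f' f'' : ℝ → ℝ} {c : ℝ} (hf : ∀ s, HasDerivAt f (f' s) s)
    (hf' : ∀ s, HasDerivAt f' (f'' s) s) (hc : ∀ s ∈ Icc 0 1, c ≤ f'' s) :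
    f 0 + f' 0 + c / 2 ≤ f 1 := by
  have hf'_ge : ∀ s ∈ Icc (0 : ℝ) 1, f' 0 + c * s ≤ f' s := fun s hs => by
    have := (convex_Icc (0 : ℝ) 1).mul_sub_le_image_sub_of_le_deriv
      (fun s _ => (hf' s).continuousAt.continuousWithinAt)
      (fun s _ => (hf' s).differentiableAt.differentiableWithinAt)
      (fun s hs => (hc s (interior_subset hs)).trans_eq (hf' s).deriv.symm)
      0 (left_mem_Icc.2 zero_le_one) s hs hs.1
    linarith
  have hderiv (s : ℝ) : HasDerivAt (fun s => f s - s * f' 0 - c / 2 * s ^ 2)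
      (f' s - f' 0 - c * s) s := by
    exact (((hf s).fun_sub ((hasDerivAt_id s).mul_const (f' 0))).fun_sub
      (((hasDerivAt_id s).fun_pow 2).const_mul (c / 2))).congr_deriv (by push_cast; ring_nf; rfl)
  have hmono : MonotoneOn (fun s => f s - s * f' 0 - c / 2 * s ^ 2) (Icc 0 1) :=
    monotoneOn_of_hasDerivWithinAt_nonneg (convex_Icc 0 1)
      (fun s _ => (hderiv s).continuousAt.continuousWithinAt)
      (fun s _ => (hderiv s).hasDerivWithinAt) fun s hs => by
        linarith [hf'_ge s (interior_subset hs)]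
  have := hmono (left_mem_Icc.2 zero_le_one) (right_mem_Icc.2 zero_le_one) zero_le_one
  linarith

variable {H : Type*} [NormedAddCommGroup H] [InnerProductSpace ℝ H] [FiniteDimensional ℝ H]

theorem exists_pos_mul_sq_norm_le_inner {X : Type*} [TopologicalSpace X] {K : Set X}
    (hK : IsCompact K) {Q : X → H →L[ℝ] H} (hQ : ContinuousOn Q K)
    (hQ_pos : ∀ x ∈ K, ∀ ξ, ξ ≠ 0 → 0 < inner ℝ (Q x ξ) ξ) :
    ∃ c > 0, ∀ x ∈ K, ∀ ξ, c * ‖ξ‖ ^ 2 ≤ inner ℝ (Q x ξ) ξ := by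
  have := FiniteDimensional.proper ℝ H
  have hcont : ContinuousOn (fun x : X × H => inner ℝ (Q x.1 x.2) x.2)
      (K ×ˢ Metric.sphere (0 : H) 1) :=
    ((hQ.comp continuousOn_fst fun x hx => hx.1).clm_apply continuousOn_snd).inner
      continuousOn_snd
  obtain ⟨c, hc, hc_le⟩ := (hK.prod (isCompact_sphere (0 : H) 1)).exists_forall_le' (a := 0) hcont
    fun x hx => hQ_pos _ hx.1 _ (ne_zero_of_mem_unit_sphere ⟨x.2, hx.2⟩)
  refine ⟨c, hc, fun x hx ξ => ?_⟩
  rcases eq_or_ne ξ 0 with rfl | hξ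
  · simp
  have hξ_pos := norm_pos_iff.2 hξ
  have hunit := hc_le (x, ‖ξ‖⁻¹ • ξ) ⟨hx, by simp [norm_smul, hξ_pos.ne']⟩
  simp only [map_smul, real_inner_smul_left, real_inner_smul_right] at hunit
  rwa [← mul_assoc, ← mul_inv, inv_mul_eq_div, le_div_iff₀ (by positivity), ← sq] at hunit

theorem exists_pos_mul_sq_norm_sub_le_of_convex {f : H → ℝ} {g : H → H} (hf : Differentiable ℝ f)
    (hg : ContDiff ℝ 1 g) (hfg : ∀ U ξ, fderiv ℝ f U ξ = inner ℝ (g U) ξ)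
    (hg_pos : ∀ U ξ, ξ ≠ 0 → 0 < inner ℝ (fderiv ℝ g U ξ) ξ) {K : Set H} (hK : IsCompact K)
    (hK_conv : Convex ℝ K) :
    ∃ c > 0, ∀ U ∈ K, ∀ V ∈ K, c * ‖U - V‖ ^ 2 ≤ f U - f V - inner ℝ (g V) (U - V) := by
  obtain ⟨c, hc, hQ⟩ := exists_pos_mul_sq_norm_le_inner hK
    (hg.continuous_fderiv one_ne_zero).continuousOn fun U _ => hg_pos U
  refine ⟨c / 2, by positivity, fun U hU V hV => ?_⟩
  set ξ := U - V with hξ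
  have hpath (s : ℝ) : HasDerivAt (fun s : ℝ => V + s • ξ) ξ s := by
    simpa using ((hasDerivAt_id s).smul_const ξ).const_add V
  have hconvex := add_half_le_of_le_deriv2 (c := c * ‖ξ‖ ^ 2)
    (fun s => ((hf _).hasFDerivAt.comp_hasDerivAt s (hpath s)).congr_deriv (hfg _ _))
    (fun s => (((hg.differentiable one_ne_zero _).hasFDerivAt.comp_hasDerivAt s
      (hpath s)).inner ℝ (hasDerivAt_const s ξ)).congr_deriv
        (by rw [inner_zero_right, zero_add]))
    (fun s hs => hQ _ (hK_conv.add_smul_sub_mem hV hU hs) ξ)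
  simp only [Function.comp_apply, zero_smul, one_smul, add_zero, hξ, add_sub_cancel] at hconvex
  linarith

end StrongConvexity

section QuadraticRemainder

variable {E Y : Type*} [NormedAddCommGroup E] [NormedSpace ℝ E] [NormedAddCommGroup Y]
  [NormedSpace ℝ Y]

theorem exists_norm_sub_sub_fderiv_le_mul_sq_norm {f : E → Y} (hf : ContDiff ℝ 2 f) {K : Set E}
    (hK : IsCompact K) (hK_conv : Convex ℝ K) :
    ∃ C, ∀ U ∈ K, ∀ V ∈ K, ‖f U - f V - fderiv ℝ f V (U - V)‖ ≤ C * ‖U - V‖ ^ 2 := by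
  have hf' : ContDiff ℝ 1 (fderiv ℝ f) := hf.fderiv_right le_rfl
  obtain ⟨C, hC⟩ := hK.exists_bound_of_continuousOn
    (hf'.continuous_fderiv one_ne_zero).continuousOn
  refine ⟨C, fun U hU V hV => ?_⟩
  have hC₀ : 0 ≤ C := (norm_nonneg _).trans (hC V hV)
  have hseg := hK_conv.segment_subset hV hU
  have hf'_le : ∀ x ∈ segment ℝ V U, ‖fderiv ℝ f x - fderiv ℝ f V‖ ≤ C * ‖U - V‖ := fun x hx =>
    (hK_conv.norm_image_sub_le_of_norm_fderiv_le
      (fun x _ => hf'.differentiable one_ne_zero x) hC hV (hseg hx)).trans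
      (mul_le_mul_of_nonneg_left (norm_sub_le_of_mem_segment hx) hC₀)
  rw [sq, ← mul_assoc]
  exact (convex_segment V U).norm_image_sub_le_of_norm_fderiv_le'
    (fun x _ => hf.differentiable two_ne_zero x) hf'_le
    (left_mem_segment ℝ V U) (right_mem_segment ℝ V U)

end QuadraticRemainder

section RelativeEntropy

variable {E H : Type*} [NormedAddCommGroup H] [InnerProductSpace ℝ H]

/-- The relative entropy `η(u) - η(v) - G(v) · (A(u) - A(v))` of the states `u` and `v`: written in
the conserved variables `A(u)`, it is the remainder of the first-order expansion of the entropy at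
`A(v)`. -/
def relEnt (A : E → H) (η : E → ℝ) (G : E → H) (u v : E) : ℝ :=
  η u - η v - inner ℝ (G v) (A u - A v)

theorem relEnt_self {A G : E → H} {η : E → ℝ} (u : E) : relEnt A η G u u = 0 := by simp [relEnt]

variable [NormedAddCommGroup E] {A G : E → H} {η : E → ℝ} {K : Set E}

theorem continuous_relEnt (hA : Continuous A) (hη : Continuous η) (hG : Continuous G) :
    Continuous fun x : E × E => relEnt A η G x.1 x.2 := by
  unfold relEnt
  fun_prop

theorem eventually_forall_norm_add_apply_le {Y : Type*} [NormedAddCommGroup Y] [NormedSpace ℝ Y]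
    {l : Filter E} (hAη : A =o[l] η) (hη : Tendsto η l atTop) (hK : IsCompact K) {c : E → Y}
    (hc : ContinuousOn c K) {D : E → H →L[ℝ] Y} (hD : ContinuousOn D K) {ε : ℝ} (hε : 0 < ε) :
    ∀ᶠ u in l, ∀ v ∈ K, ‖c v + D v (A u)‖ ≤ ε * η u := by
  obtain ⟨M, hM⟩ := hK.exists_bound_of_continuousOn (hc.prodMk hD)
  have hδ : 0 < ε / (2 * (|M| + 1)) := by positivity
  filter_upwards [hAη.def hδ, hη.eventually_ge_atTop (2 * |M| / ε), hη.eventually_ge_atTop 0]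
    with u hAu hηu_large hηu v hv
  obtain ⟨hcv, hDv⟩ := norm_prod_le_iff.1 ((hM v hv).trans (le_abs_self M))
  rw [Real.norm_of_nonneg hηu] at hAu
  rw [div_le_iff₀ hε] at hηu_large
  calc ‖c v + D v (A u)‖ ≤ ‖c v‖ + ‖D v‖ * ‖A u‖ :=
        (norm_add_le _ _).trans (by gcongr; exact (D v).le_opNorm _)
    _ ≤ |M| + (|M| + 1) * (ε / (2 * (|M| + 1)) * η u) := by gcongr; linarith
    _ = |M| + ε / 2 * η u := by field_simp
    _ ≤ ε * η u := by linarith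

theorem eventually_forall_abs_relEnt_sub_le {l : Filter E} (hAη : A =o[l] η)
    (hη : Tendsto η l atTop) (hK : IsCompact K) (hA_cont : ContinuousOn A K)
    (hη_cont : ContinuousOn η K) (hG_cont : ContinuousOn G K) :
    ∀ᶠ u in l, ∀ v ∈ K, |relEnt A η G u v - η u| ≤ 1 / 2 * η u := by
  filter_upwards [eventually_forall_norm_add_apply_le hAη hη hK
    (c := fun v => inner ℝ (G v) (A v) - η v) ((hG_cont.inner hA_cont).sub hη_cont)
    ((innerSL ℝ).continuous.comp_continuousOn hG_cont.neg) one_half_pos] with u hu v hv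
  refine le_of_eq_of_le ?_ (hu v hv)
  simp only [relEnt, Function.comp_apply, Pi.neg_apply, innerSL_apply_apply, inner_neg_left,
    inner_sub_right, Real.norm_eq_abs]
  ring_nf

theorem exists_relEnt_le_two_mul_add (hAη : A =o[cocompact E] η)
    (hη : Tendsto η (cocompact E) atTop) (hη_nonneg : ∀ u, 0 ≤ η u) (hK : IsCompact K)
    (hA_cont : Continuous A) (hη_cont : Continuous η) (hG_cont : Continuous G) :
    ∃ b ≥ 0, ∀ v ∈ K, ∀ u, relEnt A η G u v ≤ 2 * η u + b := by
  obtain ⟨K', hK', hfar⟩ := hasBasis_cocompact.eventually_iff.1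
    (eventually_forall_abs_relEnt_sub_le hAη hη hK hA_cont.continuousOn hη_cont.continuousOn
      hG_cont.continuousOn)
  obtain ⟨b, hb⟩ := (hK'.prod hK).exists_bound_of_continuousOn
    (continuous_relEnt hA_cont hη_cont hG_cont).continuousOn
  refine ⟨|b|, abs_nonneg b, fun v hv u => ?_⟩
  by_cases hu : u ∈ K'
  · linarith [(le_abs_self _).trans (hb (u, v) ⟨hu, hv⟩), le_abs_self b, hη_nonneg u]
  · linarith [(abs_le.1 (hfar hu v hv)).2, abs_nonneg b, hη_nonneg u]

theorem exists_le_add_mul_norm_sub_rpow {Φ : E × E → ℝ} (hΦ : Continuous Φ)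
    (hΦ_diag : ∀ v, Φ (v, v) = 0) (hK : IsCompact K) {p C : ℝ} (hp : 0 < p) (hC : 0 ≤ C)
    (hΦ_le : ∀ v ∈ K, ∀ u, Φ (u, v) ≤ C * (‖u‖ ^ p + 1)) {ε : ℝ} (hε : 0 < ε) :
    ∃ C', ∀ v ∈ K, ∀ u, Φ (u, v) ≤ ε + C' * ‖u - v‖ ^ p := by
  obtain ⟨M, hM⟩ := hK.exists_bound_of_continuousOn continuousOn_id
  obtain ⟨U, V, hU, -, hU₀, hKV, hUV⟩ := generalized_tube_lemma
    (isCompact_singleton (x := (0 : E))) hK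
    ((hΦ.comp (by fun_prop : Continuous fun x : E × E => (x.2 + x.1, x.2))).isOpen_preimage _
      (isOpen_Iio (a := ε)))
    (by rintro ⟨x, v⟩ ⟨rfl : x = 0, -⟩; simpa [hΦ_diag] using hε)
  obtain ⟨δ, hδ, hball⟩ := Metric.isOpen_iff.1 hU 0 (hU₀ rfl)
  refine ⟨C * ((1 + |M| / δ) ^ p + (1 / δ) ^ p), fun v hv u => ?_⟩
  rcases lt_or_ge ‖u - v‖ δ with hnear | hfar
  · have hmem : (u - v, v) ∈ U ×ˢ V := ⟨hball (by simpa using hnear), hKV hv⟩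
    have hlt : Φ (v + (u - v), v) < ε := hUV hmem
    rw [add_sub_cancel] at hlt
    exact hlt.le.trans (le_add_of_nonneg_right (by positivity))
  · have hone : 1 ≤ 1 / δ * ‖u - v‖ := by rwa [one_div, inv_mul_eq_div, one_le_div hδ]
    have hu : ‖u‖ ≤ (1 + |M| / δ) * ‖u - v‖ := by
      have hv_le : ‖v‖ ≤ |M| * (1 / δ * ‖u - v‖) :=
        ((hM v hv).trans (le_abs_self M)).trans (le_mul_of_one_le_right (abs_nonneg M) hone)
      calc ‖u‖ ≤ ‖u - v‖ + ‖v‖ := norm_le_norm_sub_add u v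
        _ ≤ ‖u - v‖ + |M| * (1 / δ * ‖u - v‖) := by gcongr
        _ = (1 + |M| / δ) * ‖u - v‖ := by ring
    calc Φ (u, v) ≤ C * (‖u‖ ^ p + 1) := hΦ_le v hv u
      _ ≤ C * (((1 + |M| / δ) * ‖u - v‖) ^ p + (1 / δ * ‖u - v‖) ^ p) := by
        gcongr
        exact Real.one_le_rpow hone hp.le
      _ = C * ((1 + |M| / δ) ^ p + (1 / δ) ^ p) * ‖u - v‖ ^ p := by
        rw [Real.mul_rpow (by positivity) (norm_nonneg _),
          Real.mul_rpow (by positivity) (norm_nonneg _)]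
        ring
      _ ≤ ε + _ := le_add_of_nonneg_left hε.le

theorem exists_relEnt_le_add_mul_norm_sub_rpow (hAη : A =o[cocompact E] η)
    (hη : Tendsto η (cocompact E) atTop) (hη_nonneg : ∀ u, 0 ≤ η u) (hK : IsCompact K)
    (hA_cont : Continuous A) (hη_cont : Continuous η) (hG_cont : Continuous G) {p β : ℝ}
    (hp : 0 < p) (hη_le : ∀ u, η u ≤ β * (‖u‖ ^ p + 1)) {ε : ℝ} (hε : 0 < ε) :
    ∃ C, ∀ v ∈ K, ∀ u, relEnt A η G u v ≤ ε + C * ‖u - v‖ ^ p := by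
  obtain ⟨b, hb, hle⟩ :=
    exists_relEnt_le_two_mul_add hAη hη hη_nonneg hK hA_cont hη_cont hG_cont
  refine exists_le_add_mul_norm_sub_rpow (continuous_relEnt hA_cont hη_cont hG_cont) relEnt_self hK
    (C := 2 * |β| + b) hp (by positivity) (fun v hv u => (hle v hv u).trans ?_) hε
  have hβ : η u ≤ |β| * (‖u‖ ^ p + 1) := (hη_le u).trans (by gcongr; exact le_abs_self β)
  have hb' : b ≤ b * (‖u‖ ^ p + 1) := le_mul_of_one_le_right hb (by
    simp only [le_add_iff_nonneg_left]; positivity)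
  linarith

end RelativeEntropy

section ConvexEntropy

variable {E H : Type*} [NormedAddCommGroup E] [NormedSpace ℝ E]
  [NormedAddCommGroup H] [InnerProductSpace ℝ H]

/-- `η` is an entropy for the conserved variables `A(u)` with multiplier `G`, and it is convex as a
function of `A(u)`: since `∇η = G · ∇A`, the form `∇²η - G · ∇²A` is the Hessian with respect to
`A(u)`, transported to the variable `u`. -/
structure IsConvexEntropy (A : E → H) (η : E → ℝ) (G : E → H) : Prop where
  contDiff_conserved : ContDiff ℝ 2 A
  contDiff_entropy : ContDiff ℝ 2 η
  contDiff_multiplier : ContDiff ℝ 1 G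
  fderiv_entropy : ∀ u ξ, fderiv ℝ η u ξ = inner ℝ (G u) (fderiv ℝ A u ξ)
  pos : ∀ u ξ, ξ ≠ 0 →
    0 < fderiv ℝ (fderiv ℝ η) u ξ ξ - inner ℝ (G u) (fderiv ℝ (fderiv ℝ A) u ξ ξ)

theorem fderiv_apply_fderiv_of_rightInverse {E' : Type*} [NormedAddCommGroup E'] [NormedSpace ℝ E']
    {A : E → E'} {S : E' → E} (hA : Differentiable ℝ A) (hS : Differentiable ℝ S)
    (hAS : Function.RightInverse S A) (U ξ : E') :
    fderiv ℝ A (S U) (fderiv ℝ S U ξ) = ξ := by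
  have hcomp := (hA (S U)).hasFDerivAt.comp U (hS U).hasFDerivAt
  rw [hAS.comp_eq_id] at hcomp
  exact congr($(hcomp.unique (hasFDerivAt_id U)) ξ)

variable {A G : E → H} {η : E → ℝ} {S : H → E} [FiniteDimensional ℝ H] {K : Set E}

theorem IsConvexEntropy.exists_pos_mul_sq_norm_sub_le_relEnt (h : IsConvexEntropy A η G)
    (hS : ContDiff ℝ 2 S) (hSA : Function.LeftInverse S A) (hAS : Function.RightInverse S A)
    (hK : IsCompact K) :
    ∃ c > 0, ∀ u ∈ K, ∀ v ∈ K, c * ‖A u - A v‖ ^ 2 ≤ relEnt A η G u v := by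
  have := FiniteDimensional.proper ℝ H
  have hS_diff : Differentiable ℝ S := hS.differentiable two_ne_zero
  have hη_diff := h.contDiff_entropy.differentiable two_ne_zero
  have hG_diff := h.contDiff_multiplier.differentiable one_ne_zero
  have hAS_fderiv := fderiv_apply_fderiv_of_rightInverse
    (h.contDiff_conserved.differentiable two_ne_zero) hS_diff hAS
  have hgrad (U ξ : H) : fderiv ℝ (η ∘ S) U ξ = inner ℝ ((G ∘ S) U) ξ := by
    rw [fderiv_comp U (hη_diff _) (hS_diff _), ContinuousLinearMap.comp_apply, h.fderiv_entropy,
      hAS_fderiv, Function.comp_apply]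
  have hpos (U ξ : H) (hξ : ξ ≠ 0) : 0 < inner ℝ (fderiv ℝ (G ∘ S) U ξ) ξ := by
    have hSξ : fderiv ℝ S U ξ ≠ 0 := fun h₀ => hξ (by rw [← hAS_fderiv U ξ, h₀, map_zero])
    have := h.pos (S U) _ hSξ
    rw [fderiv_comp U (hG_diff _) (hS_diff _), ContinuousLinearMap.comp_apply]
    rwa [fderiv_fderiv_of_fderiv_eq_inner h.contDiff_conserved hG_diff h.contDiff_entropy
      h.fderiv_entropy, add_sub_cancel_left, hAS_fderiv] at this
  obtain ⟨R, hR⟩ := (hK.image h.contDiff_conserved.continuous).isBounded.subset_closedBall 0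
  obtain ⟨c, hc, hle⟩ := exists_pos_mul_sq_norm_sub_le_of_convex (hη_diff.comp hS_diff)
    (h.contDiff_multiplier.comp (hS.of_le one_le_two)) hgrad hpos (isCompact_closedBall 0 R)
    (convex_closedBall 0 R)
  refine ⟨c, hc, fun u hu v hv => ?_⟩
  have := hle _ (hR (mem_image_of_mem A hu)) _ (hR (mem_image_of_mem A hv))
  simpa only [Function.comp_apply, hSA u, hSA v, relEnt] using this

theorem IsConvexEntropy.relEnt_nonneg (h : IsConvexEntropy A η G) (hS : ContDiff ℝ 2 S)
    (hSA : Function.LeftInverse S A) (hAS : Function.RightInverse S A) (u v : E) :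
    0 ≤ relEnt A η G u v := by
  obtain ⟨c, hc, hle⟩ := h.exists_pos_mul_sq_norm_sub_le_relEnt hS hSA hAS
    (K := {u, v}) ((Set.finite_singleton v).insert u).isCompact
  exact le_trans (by positivity) (hle u (by simp) v (by simp))

theorem IsConvexEntropy.eq_of_relEnt_eq_zero (h : IsConvexEntropy A η G) (hS : ContDiff ℝ 2 S)
    (hSA : Function.LeftInverse S A) (hAS : Function.RightInverse S A) {u v : E}
    (huv : relEnt A η G u v = 0) : u = v := by
  obtain ⟨c, hc, hle⟩ := h.exists_pos_mul_sq_norm_sub_le_relEnt hS hSA hAS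
    (K := {u, v}) ((Set.finite_singleton v).insert u).isCompact
  have hle_zero := (hle u (by simp) v (by simp)).trans_eq huv
  have hnorm : ‖A u - A v‖ ^ 2 = 0 :=
    le_antisymm (nonpos_of_mul_nonpos_right hle_zero hc) (sq_nonneg _)
  exact hSA.injective (sub_eq_zero.1 (norm_eq_zero.1 (pow_eq_zero_iff two_ne_zero |>.1 hnorm)))

variable {Y : Type*} [NormedAddCommGroup Y] [NormedSpace ℝ Y] {F : E → Y}

theorem IsConvexEntropy.exists_norm_remainder_le_relEnt_of_mem (h : IsConvexEntropy A η G)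
    (hS : ContDiff ℝ 2 S) (hSA : Function.LeftInverse S A) (hAS : Function.RightInverse S A)
    (hF : ContDiff ℝ 2 F) (hK : IsCompact K) :
    ∃ C ≥ 0, ∀ u ∈ K, ∀ v ∈ K,
      ‖F u - F v - fderiv ℝ F v (fderiv ℝ S (A v) (A u - A v))‖ ≤ C * relEnt A η G u v := by
  have := FiniteDimensional.proper ℝ H
  obtain ⟨R, hR⟩ := (hK.image h.contDiff_conserved.continuous).isBounded.subset_closedBall 0
  obtain ⟨C, hC⟩ := exists_norm_sub_sub_fderiv_le_mul_sq_norm (hF.comp hS)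
    (isCompact_closedBall 0 R) (convex_closedBall 0 R)
  obtain ⟨c, hc, hle⟩ := h.exists_pos_mul_sq_norm_sub_le_relEnt hS hSA hAS hK
  refine ⟨|C| / c, by positivity, fun u hu v hv => ?_⟩
  have hrem := hC _ (hR (mem_image_of_mem A hu)) _ (hR (mem_image_of_mem A hv))
  rw [fderiv_comp _ (hF.differentiable two_ne_zero _) (hS.differentiable two_ne_zero _),
    ContinuousLinearMap.comp_apply] at hrem
  simp only [Function.comp_apply, hSA u, hSA v] at hrem
  calc _ ≤ C * ‖A u - A v‖ ^ 2 := hrem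
    _ ≤ |C| / c * (c * ‖A u - A v‖ ^ 2) := by
      rw [← mul_assoc, div_mul_cancel₀ _ hc.ne']
      gcongr
      exact le_abs_self C
    _ ≤ |C| / c * relEnt A η G u v := by gcongr; exact hle u hu v hv

theorem IsConvexEntropy.exists_norm_remainder_le_relEnt (h : IsConvexEntropy A η G)
    (hS : ContDiff ℝ 2 S) (hSA : Function.LeftInverse S A) (hAS : Function.RightInverse S A)
    (hη : Tendsto η (cocompact E) atTop) (hAη : A =o[cocompact E] η) (hF : ContDiff ℝ 2 F)
    (hFη : F =o[cocompact E] η) (hK : IsCompact K) :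
    ∃ C, ∀ v ∈ K, ∀ u,
      ‖F u - F v - fderiv ℝ F v (fderiv ℝ S (A v) (A u - A v))‖ ≤ C * relEnt A η G u v := by
  set D : E → H →L[ℝ] Y := fun v => (fderiv ℝ F v).comp (fderiv ℝ S (A v))
  have hA_cont := h.contDiff_conserved.continuous
  have hD_cont : Continuous D := (hF.continuous_fderiv two_ne_zero).clm_comp
    ((hS.continuous_fderiv two_ne_zero).comp hA_cont)
  have hfar : ∀ᶠ u in cocompact E, ∀ v ∈ K,
      ‖F u - F v - D v (A u - A v)‖ ≤ 4 * relEnt A η G u v := by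
    filter_upwards [hFη.def one_pos, hη.eventually_ge_atTop 0,
      eventually_forall_norm_add_apply_le hAη hη hK (D := D) (c := fun v => F v - D v (A v))
        (hF.continuous.sub (hD_cont.clm_apply hA_cont)).continuousOn hD_cont.continuousOn one_pos,
      eventually_forall_abs_relEnt_sub_le (G := G) hAη hη hK hA_cont.continuousOn
        h.contDiff_entropy.continuous.continuousOn h.contDiff_multiplier.continuous.continuousOn]
      with u hFu hηu haff hrel v hv
    rw [Real.norm_of_nonneg hηu] at hFu
    calc ‖F u - F v - D v (A u - A v)‖ = ‖F u - (F v - D v (A v) + D v (A u))‖ := by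
          rw [map_sub]; congr 1; abel
      _ ≤ ‖F u‖ + ‖F v - D v (A v) + D v (A u)‖ := norm_sub_le _ _
      _ ≤ 4 * relEnt A η G u v := by linarith [haff v hv, (abs_le.1 (hrel v hv)).1]
  obtain ⟨K', hK', hfar⟩ := hasBasis_cocompact.eventually_iff.1 hfar
  obtain ⟨C, hC₀, hC⟩ :=
    h.exists_norm_remainder_le_relEnt_of_mem hS hSA hAS hF (hK'.union hK)
  refine ⟨C + 4, fun v hv u => ?_⟩
  have hrel := h.relEnt_nonneg hS hSA hAS u v
  by_cases hu : u ∈ K'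
  · exact (hC u (.inl hu) v (.inr hv)).trans (by gcongr; linarith)
  · exact (hfar hu v hv).trans (by gcongr; linarith)

end ConvexEntropy

/-! ### The relative entropy inequality -/

section Fluxes

variable {ι E H : Type*} [NormedAddCommGroup E] [NormedSpace ℝ E] [NormedAddCommGroup H]
  [InnerProductSpace ℝ H] {f : ι → E → H} {Q : ι → E → ℝ} {G : E → H}

/-- `G` is a multiplier turning the system `∑ᵢ ∂ᵢ fᵢ(u) = 0` into the scalar law
`∑ᵢ ∂ᵢ Qᵢ(u) = 0`. The index `i` runs over the directions of space-time, so that the conserved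
variables and the entropy are among the fluxes `fᵢ` and `Qᵢ`. -/
structure IsMultiplier (f : ι → E → H) (Q : ι → E → ℝ) (G : E → H) : Prop where
  contDiff_flux : ∀ i, ContDiff ℝ 2 (f i)
  contDiff_entropyFlux : ∀ i, ContDiff ℝ 1 (Q i)
  contDiff_multiplier : ContDiff ℝ 1 G
  fderiv_entropyFlux : ∀ i u ξ, fderiv ℝ (Q i) u ξ = inner ℝ (G u) (fderiv ℝ (f i) u ξ)

variable [Fintype ι]

theorem IsMultiplier.sum_fderiv_entropyFlux_eq_zero (h : IsMultiplier f Q G) {v : E} {w : ι → E}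
    (hvw : ∑ i, fderiv ℝ (f i) v (w i) = 0) : ∑ i, fderiv ℝ (Q i) v (w i) = 0 := by
  simp only [h.fderiv_entropyFlux, ← inner_sum, hvw, inner_zero_right]

theorem IsMultiplier.sum_inner_fderiv_fderiv_eq_zero (h : IsMultiplier f Q G) {v : E} {w : ι → E}
    (hvw : ∑ i, fderiv ℝ (f i) v (w i) = 0) (ζ : E) :
    ∑ i, inner ℝ (fderiv ℝ G v (w i)) (fderiv ℝ (f i) v ζ) = 0 := by
  simp only [fun i => inner_fderiv_fderiv_comm (h.contDiff_flux i) h.contDiff_multiplier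
    ((h.contDiff_entropyFlux i).differentiable one_ne_zero) (h.fderiv_entropyFlux i) v (w i) ζ,
    ← inner_sum, hvw, inner_zero_right]

-- The part of the fluxes that is linear in `ζ` is annihilated by the equation for `v`.
theorem IsMultiplier.abs_sum_inner_fderiv_le (h : IsMultiplier f Q G) {u v ζ : E} {w : ι → E}
    (hvw : ∑ i, fderiv ℝ (f i) v (w i) = 0) {M r : ℝ} {C : ι → ℝ}
    (hM : ∀ i, ‖fderiv ℝ G v (w i)‖ ≤ M)
    (hC : ∀ i, ‖f i u - f i v - fderiv ℝ (f i) v ζ‖ ≤ C i * r) :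
    |∑ i, inner ℝ (fderiv ℝ G v (w i)) (f i u - f i v)| ≤ M * (∑ i, C i) * r := by
  calc |∑ i, inner ℝ (fderiv ℝ G v (w i)) (f i u - f i v)|
      = |∑ i, inner ℝ (fderiv ℝ G v (w i)) (f i u - f i v - fderiv ℝ (f i) v ζ)| := by
        simp only [inner_sub_right _ _ (fderiv ℝ (f _) v ζ), Finset.sum_sub_distrib,
          h.sum_inner_fderiv_fderiv_eq_zero hvw, sub_zero]
    _ ≤ ∑ i, M * (C i * r) := (Finset.abs_sum_le_sum_abs _ _).trans <| Finset.sum_le_sum fun i _ =>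
        (abs_real_inner_le_norm _ _).trans <| mul_le_mul (hM i) (hC i) (norm_nonneg _)
          ((norm_nonneg _).trans (hM i))
    _ = M * (∑ i, C i) * r := by rw [← Finset.mul_sum, ← Finset.sum_mul, mul_assoc]

end Fluxes

section TimeWeights

open Function

variable {d : ℕ} {T a b : ℝ} {φ : ℝ → ℝ}

theorem isTest_comp_fst (hφ : ContDiff ℝ ∞ φ) (ha : 0 < a) (hb : b < T)
    (hφ_supp : support φ ⊆ Icc a b) : IsTest T fun z : SpaceTime d => φ z.1 :=
  ⟨hφ.comp contDiff_fst, a, b, ha, hb, fun z hz => support_subset_iff'.1 hφ_supp z.1 hz⟩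

theorem support_comp_fst_subset_slab (hφ_supp : support φ ⊆ Icc a b) :
    support (fun z : SpaceTime d => φ z.1) ⊆ slab d a b :=
  fun _ hz => mem_slab.2 (hφ_supp hz)

theorem support_deriv_subset_Icc (hφ_supp : support φ ⊆ Icc a b) : support (deriv φ) ⊆ Icc a b :=
  (support_deriv_subset).trans (closure_minimal hφ_supp isClosed_Icc)

theorem integrableOn_slab_comp_fst_mul {χ : ℝ → ℝ} (hχ : Continuous χ) {f : SpaceTime d → ℝ}
    (hf : IntegrableOn f (slab d a b)) : IntegrableOn (fun z => χ z.1 * f z) (slab d a b) :=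
  hf.continuousOn_mul (hχ.comp continuous_fst).continuousOn (isCompact_slab a b)

variable {E : Type*} [NormedAddCommGroup E] [NormedSpace ℝ E]

theorem sum_integral_cyl_pderiv_comp_fst_smul (ha : 0 < a) (hb : b < T)
    (hφ_supp : support φ ⊆ Icc a b) (f : Option (Fin d) → SpaceTime d → E) :
    ∑ i, ∫ z in cyl d T, pderiv i (fun z : SpaceTime d => φ z.1) z • f i z =
      ∫ z in slab d a b, deriv φ z.1 • f none z := by
  simp only [Fintype.sum_option, pderiv_none_comp_fst, pderiv_some_comp_fst, zero_smul,
    integral_zero, Finset.sum_const_zero, add_zero]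
  exact setIntegral_cyl_eq_slab ha hb ((support_smul_subset_left _ _).trans
    (support_comp_fst_subset_slab (support_deriv_subset_Icc hφ_supp)))

end TimeWeights

section RelativeEntropyIdentity

open Function

variable {d : ℕ} {T a b : ℝ} {E H : Type*} [NormedAddCommGroup E] [NormedSpace ℝ E]
  [FiniteDimensional ℝ E] [NormedAddCommGroup H] [InnerProductSpace ℝ H]
  {u v : SpaceTime d → E} {w : Option (Fin d) → SpaceTime d → E} {f : Option (Fin d) → E → H}
  {Q : Option (Fin d) → E → ℝ} {G : E → H}

theorem HasWeakGrad.locallyIntegrableOn_comp {Y : Type*} [NormedAddCommGroup Y]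
    (h : HasWeakGrad T v w) {g : E → Y} (hg : Continuous g) :
    LocallyIntegrableOn (fun z => g (v z)) (openCyl d T) := by
  have := FiniteDimensional.proper ℝ E
  exact (IntegrableOn.mono_set ((memLp_top_comp_of_continuous hg h.memLp).integrable le_top)
    (prod_mono Ioo_subset_Ico_self subset_rfl)).locallyIntegrableOn

theorem HasWeakGrad.sum_integral_pderiv_smul_sub [CompleteSpace H] (h : HasWeakGrad T v w)
    (hf : ∀ i, ContDiff ℝ 1 (f i))
    (hvw : ∀ᵐ z ∂volume.restrict (cyl d T), ∑ i, fderiv ℝ (f i) (v z) (w i z) = 0)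
    (hu_int : ∀ i, LocallyIntegrableOn (fun z => f i (u z)) (openCyl d T))
    (hu_eq : ∀ φ, IsTest T φ → ∑ i, ∫ z in cyl d T, pderiv i φ z • f i (u z) = 0)
    {φ : SpaceTime d → ℝ} (hφ : IsTest T φ) :
    ∑ i, ∫ z in cyl d T, pderiv i φ z • (f i (u z) - f i (v z)) = 0 := by
  obtain ⟨a, b, ha, hb, hφ_supp⟩ := hφ.exists_support_subset_slab
  have hcyl (i : Option (Fin d)) (g : SpaceTime d → H) :
      ∫ z in cyl d T, pderiv i φ z • g z = ∫ z in slab d a b, pderiv i φ z • g z :=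
    setIntegral_cyl_eq_slab ha hb
      ((support_smul_subset_left _ _).trans (support_pderiv_subset_slab hφ_supp i))
  have hint (i : Option (Fin d)) {g : SpaceTime d → H} (hg : LocallyIntegrableOn g (openCyl d T)) :
      IntegrableOn (fun z => pderiv i φ z • g z) (slab d a b) :=
    (integrableOn_slab hg ha hb).continuousOn_smul (hφ.isC1.continuous_pderiv i).continuousOn
      (isCompact_slab a b)
  rw [← sub_zero (0 : H)]
  nth_rw 1 [← hu_eq φ hφ]
  rw [← h.sum_integral_pderiv_smul_comp hf hvw hφ, ← Finset.sum_sub_distrib]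
  refine Finset.sum_congr rfl fun i _ => ?_
  rw [hcyl, hcyl, hcyl, ← integral_sub (hint i (hu_int i))
    (hint i (h.locallyIntegrableOn_comp (hf i).continuous))]
  simp only [smul_sub]

theorem integrableOn_slab_inner_of_memLp_top {m B : SpaceTime d → H}
    (hm : MemLp m ⊤ (volume.restrict (cyl d T))) (ha : 0 < a) (hb : b < T)
    (hB : IntegrableOn B (slab d a b)) :
    IntegrableOn (fun z => inner ℝ (m z) (B z)) (slab d a b) :=
  integrable_bilin_of_memLp_top (innerSL ℝ).flip hB
    (hm.mono_measure (Measure.restrict_mono (slab_subset_cyl ha hb) le_rfl))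

theorem HasWeakGrad.integrableOn_relEnt_comp (h : HasWeakGrad T v w) {A : E → H} {η : E → ℝ}
    (hA : Continuous A) (hη : Continuous η) (hG : Continuous G)
    (hAu : LocallyIntegrableOn (fun z => A (u z)) (openCyl d T))
    (hηu : LocallyIntegrableOn (fun z => η (u z)) (openCyl d T)) (ha : 0 < a) (hb : b < T) :
    IntegrableOn (fun z => relEnt A η G (u z) (v z)) (slab d a b) := by
  have := FiniteDimensional.proper ℝ E
  exact (integrableOn_slab (hηu.sub (h.locallyIntegrableOn_comp hη)) ha hb).sub
    (integrableOn_slab_inner_of_memLp_top (memLp_top_comp_of_continuous hG h.memLp) ha hb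
      (integrableOn_slab (hAu.sub (h.locallyIntegrableOn_comp hA)) ha hb))

variable [FiniteDimensional ℝ H] {φ : ℝ → ℝ}

theorem HasWeakGrad.integral_deriv_mul_inner_comp (h : HasWeakGrad T v w)
    (hG : ContDiff ℝ 1 G) {B : Option (Fin d) → SpaceTime d → H}
    (hB : ∀ i, LocallyIntegrableOn (B i) (openCyl d T))
    (hB_eq : ∀ φ, IsTest T φ → ∑ i, ∫ z in cyl d T, pderiv i φ z • B i z = 0)
    (ha : 0 < a) (hb : b < T) (hφ : ContDiff ℝ 1 φ) (hφ_supp : support φ ⊆ Icc a b) :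
    ∫ z in slab d a b, deriv φ z.1 * inner ℝ (G (v z)) (B none z) =
      -∫ z in slab d a b, φ z.1 * ∑ i, inner ℝ (fderiv ℝ G (v z) (w i z)) (B i z) := by
  have hGv := h.comp hG
  have hψ := isC1_comp_fst (d := d) hφ
  have hint {χ : SpaceTime d → ℝ} (hχ : Continuous χ) {m : SpaceTime d → H}
      (hm : MemLp m ⊤ (volume.restrict (cyl d T))) (i : Option (Fin d)) :
      IntegrableOn (fun z => χ z * inner ℝ (m z) (B i z)) (slab d a b) :=
    (integrableOn_slab_inner_of_memLp_top hm ha hb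
      (integrableOn_slab (hB i) ha hb)).continuousOn_mul hχ.continuousOn (isCompact_slab a b)
  have hsum := hGv.sum_integral_inner_eq_zero hB hB_eq ha hb hψ
    (support_comp_fst_subset_slab hφ_supp)
  simp only [fun i => integral_add (hint (hψ.continuous_pderiv i) hGv.memLp i)
    (hint hψ.continuous (hGv.memLp_grad i) i), Finset.sum_add_distrib] at hsum
  rw [← integral_finsetSum _ fun i _ => hint hψ.continuous (hGv.memLp_grad i) i] at hsum
  simpa only [Fintype.sum_option (fun i => ∫ _ in _, pderiv i _ _ * _), pderiv_none_comp_fst,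
    pderiv_some_comp_fst, zero_mul, integral_zero, Finset.sum_const_zero, add_zero,
    ← Finset.mul_sum] using eq_neg_of_add_eq_zero_left hsum

theorem HasWeakGrad.integral_deriv_mul_relEnt (h : HasWeakGrad T v w) (hfQ : IsMultiplier f Q G)
    (hvw : ∀ᵐ z ∂volume.restrict (cyl d T), ∑ i, fderiv ℝ (f i) (v z) (w i z) = 0)
    (hu_int : ∀ i, LocallyIntegrableOn (fun z => f i (u z)) (openCyl d T))
    (hu_eq : ∀ φ, IsTest T φ → ∑ i, ∫ z in cyl d T, pderiv i φ z • f i (u z) = 0)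
    (hQu : LocallyIntegrableOn (fun z => Q none (u z)) (openCyl d T))
    (ha : 0 < a) (hb : b < T) (hφ : ContDiff ℝ ∞ φ) (hφ_supp : support φ ⊆ Icc a b) :
    ∫ z in slab d a b, deriv φ z.1 * relEnt (f none) (Q none) G (u z) (v z) =
      (∫ z in slab d a b, deriv φ z.1 * Q none (u z)) + ∫ z in slab d a b,
        φ z.1 * ∑ i, inner ℝ (fderiv ℝ G (v z) (w i z)) (f i (u z) - f i (v z)) := by
  have := FiniteDimensional.proper ℝ E
  have hφ₁ : ContDiff ℝ 1 φ := hφ.of_le (by exact_mod_cast le_top)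
  have hf₁ (i : Option (Fin d)) := (hfQ.contDiff_flux i).of_le one_le_two
  have hB (i : Option (Fin d)) :
      LocallyIntegrableOn (fun z => f i (u z) - f i (v z)) (openCyl d T) :=
    (hu_int i).sub (h.locallyIntegrableOn_comp (hf₁ i).continuous)
  have hQv : ∫ z in slab d a b, deriv φ z.1 * Q none (v z) = 0 := by
    rw [← h.sum_integral_pderiv_smul_comp hfQ.contDiff_entropyFlux
      (hvw.mono fun z => hfQ.sum_fderiv_entropyFlux_eq_zero) (isTest_comp_fst hφ ha hb hφ_supp)]
    exact (sum_integral_cyl_pderiv_comp_fst_smul ha hb hφ_supp fun i z => Q i (v z)).symm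
  have hGB := h.integral_deriv_mul_inner_comp hfQ.contDiff_multiplier hB
    (fun φ hφ => h.sum_integral_pderiv_smul_sub hf₁ hvw hu_int hu_eq hφ) ha hb hφ₁ hφ_supp
  have hint {g : SpaceTime d → ℝ} (hg : IntegrableOn g (slab d a b)) :
      IntegrableOn (fun z => deriv φ z.1 * g z) (slab d a b) :=
    integrableOn_slab_comp_fst_mul (hφ₁.continuous_deriv le_rfl) hg
  have hQu_int := hint (integrableOn_slab hQu ha hb)
  have hQv_int := hint (integrableOn_slab
    (h.locallyIntegrableOn_comp (hfQ.contDiff_entropyFlux none).continuous) ha hb)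
  have hGB_int := hint (integrableOn_slab_inner_of_memLp_top
    (memLp_top_comp_of_continuous hfQ.contDiff_multiplier.continuous h.memLp) ha hb
    (integrableOn_slab (hB none) ha hb))
  simp only [relEnt, mul_sub]
  refine (integral_sub (hQu_int.sub hQv_int) hGB_int).trans ?_
  rw [integral_sub' hQu_int hQv_int, hQv, hGB, sub_zero, sub_neg_eq_add]

theorem HasWeakGrad.integral_deriv_add_mul_relEnt_nonneg (h : HasWeakGrad T v w)
    (hfQ : IsMultiplier f Q G)
    (hvw : ∀ᵐ z ∂volume.restrict (cyl d T), ∑ i, fderiv ℝ (f i) (v z) (w i z) = 0)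
    (hu_int : ∀ i, LocallyIntegrableOn (fun z => f i (u z)) (openCyl d T))
    (hu_eq : ∀ φ, IsTest T φ → ∑ i, ∫ z in cyl d T, pderiv i φ z • f i (u z) = 0)
    (hQu : LocallyIntegrableOn (fun z => Q none (u z)) (openCyl d T)) {Λ : ℝ}
    (hΛ : ∀ᵐ z ∂volume.restrict (cyl d T),
      |∑ i, inner ℝ (fderiv ℝ G (v z) (w i z)) (f i (u z) - f i (v z))| ≤
        Λ * relEnt (f none) (Q none) G (u z) (v z))
    (ha : 0 < a) (hb : b < T) (hφ : ContDiff ℝ ∞ φ) (hφ_supp : support φ ⊆ Icc a b)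
    (hφ_nonneg : ∀ t, 0 ≤ φ t)
    (hQu_ineq : 0 ≤ ∫ z in slab d a b, deriv φ z.1 * Q none (u z)) :
    0 ≤ ∫ z in slab d a b,
      (deriv φ z.1 + Λ * φ z.1) * relEnt (f none) (Q none) G (u z) (v z) := by
  have := FiniteDimensional.proper ℝ E
  have hf_cont (i : Option (Fin d)) := (hfQ.contDiff_flux i).continuous
  have hrel := h.integrableOn_relEnt_comp (hf_cont none) (hfQ.contDiff_entropyFlux none).continuous
    hfQ.contDiff_multiplier.continuous (hu_int none) hQu ha hb
  have hsum : IntegrableOn (fun z => ∑ i, inner ℝ (fderiv ℝ G (v z) (w i z))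
      (f i (u z) - f i (v z))) (slab d a b) :=
    integrable_finsetSum _ fun i _ => integrableOn_slab_inner_of_memLp_top
      ((h.comp hfQ.contDiff_multiplier).memLp_grad i) ha hb
      (integrableOn_slab ((hu_int i).sub (h.locallyIntegrableOn_comp (hf_cont i))) ha hb)
  have hφ_sum := integrableOn_slab_comp_fst_mul hφ.continuous hsum
  have hφ_rel := integrableOn_slab_comp_fst_mul hφ.continuous (hrel.const_mul Λ)
  have hφ'_rel := integrableOn_slab_comp_fst_mul
    (hφ.continuous_deriv (by exact_mod_cast le_top)) hrel
  have hle : -∫ z in slab d a b, φ z.1 * ∑ i, inner ℝ (fderiv ℝ G (v z) (w i z))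
      (f i (u z) - f i (v z)) ≤
      ∫ z in slab d a b, φ z.1 * (Λ * relEnt (f none) (Q none) G (u z) (v z)) := by
    rw [← integral_neg]
    refine integral_mono_ae hφ_sum.neg hφ_rel ?_
    filter_upwards [ae_mono (Measure.restrict_mono (slab_subset_cyl ha hb) le_rfl) hΛ] with z hz
    rw [← mul_neg]
    exact mul_le_mul_of_nonneg_left ((neg_le_abs _).trans hz) (hφ_nonneg z.1)
  simp only [add_mul, mul_assoc, mul_left_comm Λ]
  rw [integral_add hφ'_rel hφ_rel,
    h.integral_deriv_mul_relEnt hfQ hvw hu_int hu_eq hQu ha hb hφ hφ_supp]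
  linarith

end RelativeEntropyIdentity

section RelativeEntropyBound

variable {d : ℕ} {T : ℝ} {E H : Type*} [NormedAddCommGroup E] [NormedSpace ℝ E]
  [FiniteDimensional ℝ E] [NormedAddCommGroup H] [InnerProductSpace ℝ H] [FiniteDimensional ℝ H]
  {v : SpaceTime d → E} {w : Option (Fin d) → SpaceTime d → E} {f : Option (Fin d) → E → H}
  {Q : Option (Fin d) → E → ℝ} {G : E → H} {S : H → E} {K : Set E}

theorem HasWeakGrad.exists_ae_abs_sum_inner_le_relEnt (h : HasWeakGrad T v w)
    (hfQ : IsMultiplier f Q G) (hconv : IsConvexEntropy (f none) (Q none) G) (hS : ContDiff ℝ 2 S)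
    (hSf : Function.LeftInverse S (f none)) (hfS : Function.RightInverse S (f none))
    (hQ : Tendsto (Q none) (cocompact E) atTop) (hfη : ∀ i, f i =o[cocompact E] Q none)
    (hK : IsCompact K) (hvK : ∀ᵐ z ∂volume.restrict (cyl d T), v z ∈ K)
    (hvw : ∀ᵐ z ∂volume.restrict (cyl d T), ∑ i, fderiv ℝ (f i) (v z) (w i z) = 0) :
    ∃ Λ ≥ 0, ∀ u : SpaceTime d → E, ∀ᵐ z ∂volume.restrict (cyl d T),
      |∑ i, inner ℝ (fderiv ℝ G (v z) (w i z)) (f i (u z) - f i (v z))| ≤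
        Λ * relEnt (f none) (Q none) G (u z) (v z) := by
  have hrem (i : Option (Fin d)) := hconv.exists_norm_remainder_le_relEnt hS hSf hfS hQ (hfη none)
    (hfQ.contDiff_flux i) (hfη i) hK
  choose C hC using hrem
  obtain ⟨-, M, hM⟩ :=
    memLp_top_iff_exists_ae_norm_le.1 (h.comp hfQ.contDiff_multiplier).memLp_prodMk
  refine ⟨|M * ∑ i, C i|, abs_nonneg _, fun u => ?_⟩
  filter_upwards [hM, hvK, hvw] with z hMz hvz hvwz
  refine (hfQ.abs_sum_inner_fderiv_le hvwz
    (fun i => ((norm_le_pi_norm _ i).trans (norm_snd_le _)).trans hMz)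
    fun i => hC i (v z) hvz (u z)).trans ?_
  gcongr
  · exact hconv.relEnt_nonneg hS hSf hfS _ _
  · exact le_abs_self _

end RelativeEntropyBound

/-! ### Grönwall's lemma in weak form -/

section Gronwall

open Function

/-- A smooth nondecreasing function equal to `0` on `(-∞, s₀]` and to `1` on `[s₁, ∞)`, for
`s₀ < s₁`. -/
def smoothStep (s₀ s₁ t : ℝ) : ℝ := Real.smoothTransition ((t - s₀) / (s₁ - s₀))

variable {s₀ s₁ t : ℝ}

theorem contDiff_smoothStep {m : ℕ∞} : ContDiff ℝ m (smoothStep s₀ s₁) :=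
  Real.smoothTransition.contDiff.comp (by fun_prop)

theorem differentiable_smoothStep : Differentiable ℝ (smoothStep s₀ s₁) :=
  (contDiff_smoothStep (m := 1)).differentiable one_ne_zero

theorem smoothStep_nonneg : 0 ≤ smoothStep s₀ s₁ t := Real.smoothTransition.nonneg _

theorem smoothStep_le_one : smoothStep s₀ s₁ t ≤ 1 := Real.smoothTransition.le_one _

theorem smoothStep_of_le (hs : s₀ < s₁) (ht : t ≤ s₀) : smoothStep s₀ s₁ t = 0 :=
  Real.smoothTransition.zero_of_nonpos
    (div_nonpos_of_nonpos_of_nonneg (sub_nonpos.2 ht) (sub_nonneg.2 hs.le))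

theorem smoothStep_of_ge (hs : s₀ < s₁) (ht : s₁ ≤ t) : smoothStep s₀ s₁ t = 1 :=
  Real.smoothTransition.one_of_one_le
    ((one_le_div (sub_pos.2 hs)).2 (sub_le_sub_right ht s₀))

theorem deriv_smoothStep_nonneg (hs : s₀ < s₁) : 0 ≤ deriv (smoothStep s₀ s₁) t :=
  Monotone.deriv_nonneg fun x y hxy => Real.smoothTransition.monotone (by
    have := sub_pos.2 hs
    gcongr)

theorem deriv_smoothStep_of_gt (hs : s₀ < s₁) (ht : s₁ < t) :
    deriv (smoothStep s₀ s₁) t = 0 := by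
  have hconst : smoothStep s₀ s₁ =ᶠ[𝓝 t] fun _ => 1 := by
    filter_upwards [Ioi_mem_nhds ht] with x hx using smoothStep_of_ge hs (le_of_lt hx)
  rw [hconst.deriv_eq, deriv_const]

theorem integral_Icc_deriv_smoothStep_le_one {a b : ℝ} (hab : a ≤ b) :
    ∫ t in Icc a b, deriv (smoothStep s₀ s₁) t ≤ 1 := by
  rw [integral_Icc_eq_integral_Ioc, ← intervalIntegral.integral_of_le hab,
    intervalIntegral.integral_deriv_eq_sub (fun t _ => differentiable_smoothStep t)
      (((contDiff_smoothStep (m := 1)).continuous_deriv le_rfl).intervalIntegrable _ _)]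
  linarith [smoothStep_le_one (s₀ := s₀) (s₁ := s₁) (t := b),
    smoothStep_nonneg (s₀ := s₀) (s₁ := s₁) (t := a)]

theorem integral_deriv_smoothStep_mul_le (hs : s₀ < s₁) {a b κ : ℝ} (hab : a ≤ b) (hκ : 0 ≤ κ)
    {E : ℝ → ℝ} (hE : IntegrableOn E (Icc a b)) (hEκ : ∀ t ∈ Icc a s₁, E t ≤ κ) :
    ∫ t in Icc a b, deriv (smoothStep s₀ s₁) t * E t ≤ κ := by
  have hcont : Continuous (deriv (smoothStep s₀ s₁)) :=
    (contDiff_smoothStep (m := 1)).continuous_deriv le_rfl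
  calc ∫ t in Icc a b, deriv (smoothStep s₀ s₁) t * E t
      ≤ ∫ t in Icc a b, deriv (smoothStep s₀ s₁) t * κ := by
        refine setIntegral_mono_on (hE.continuousOn_mul hcont.continuousOn isCompact_Icc)
          (hcont.continuousOn.integrableOn_Icc.mul_const κ) measurableSet_Icc fun t ht => ?_
        rcases le_or_gt t s₁ with hts | hts
        · exact mul_le_mul_of_nonneg_left (hEκ t ⟨ht.1, hts⟩) (deriv_smoothStep_nonneg hs)
        · rw [deriv_smoothStep_of_gt hs hts, zero_mul, zero_mul]
    _ ≤ κ := by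
      rw [integral_mul_const]
      exact mul_le_of_le_one_left hκ (integral_Icc_deriv_smoothStep_le_one hab)

variable {T Λ a t₁ t₂ b : ℝ}

/-- The weight `e^{-(Λ+1)t}` cut off to the interval `[a, b]`: it is not modified on `[2a, t₂]`.
With the rate `Λ + 1`, instead of `Λ`, an inequality `E' ≤ Λ E` bounds the weighted integral of `E`
itself. -/
def gronwallWeight (Λ a t₂ b t : ℝ) : ℝ :=
  Real.exp (-(Λ + 1) * t) * (smoothStep a (2 * a) t * (1 - smoothStep t₂ b t))

theorem contDiff_gronwallWeight {m : ℕ∞} : ContDiff ℝ m (gronwallWeight Λ a t₂ b) :=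
  (Real.contDiff_exp.comp (by fun_prop)).mul
    (contDiff_smoothStep.mul (contDiff_const.sub contDiff_smoothStep))

theorem gronwallWeight_nonneg : 0 ≤ gronwallWeight Λ a t₂ b t :=
  mul_nonneg (Real.exp_pos _).le (mul_nonneg smoothStep_nonneg (sub_nonneg.2 smoothStep_le_one))

theorem support_gronwallWeight_subset (ha : 0 < a) (hb : t₂ < b) :
    support (gronwallWeight Λ a t₂ b) ⊆ Icc a b := by
  refine support_subset_iff'.2 fun t ht => ?_
  rcases lt_or_ge t a with hta | hta
  · simp [gronwallWeight, smoothStep_of_le (by linarith : a < 2 * a) hta.le]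
  · simp [gronwallWeight, smoothStep_of_ge hb (not_le.1 fun htb => ht ⟨hta, htb⟩).le]

theorem gronwallWeight_of_mem_Icc (ha : 0 < a) (hb : t₂ < b) (ht : t ∈ Icc (2 * a) t₂) :
    gronwallWeight Λ a t₂ b t = Real.exp (-(Λ + 1) * t) := by
  simp [gronwallWeight, smoothStep_of_ge (by linarith : a < 2 * a) ht.1, smoothStep_of_le hb ht.2]

theorem deriv_gronwallWeight_add_le (hΛ : 0 ≤ Λ) (ha : 0 < a) (hb : t₂ < b) (ht : 0 ≤ t) :
    deriv (gronwallWeight Λ a t₂ b) t + Λ * gronwallWeight Λ a t₂ b t ≤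
      deriv (smoothStep a (2 * a)) t - gronwallWeight Λ a t₂ b t := by
  have hexp : HasDerivAt (fun s => Real.exp (-(Λ + 1) * s))
      (Real.exp (-(Λ + 1) * t) * (-(Λ + 1) * 1)) t := ((hasDerivAt_id t).const_mul _).exp
  have hderiv : deriv (gronwallWeight Λ a t₂ b) t = -(Λ + 1) * gronwallWeight Λ a t₂ b t +
      Real.exp (-(Λ + 1) * t) * (deriv (smoothStep a (2 * a)) t * (1 - smoothStep t₂ b t) -
        smoothStep a (2 * a) t * deriv (smoothStep t₂ b) t) :=
    (hexp.mul ((differentiable_smoothStep t).hasDerivAt.mul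
      ((differentiable_smoothStep t).hasDerivAt.const_sub 1))).deriv.trans (by
        simp only [gronwallWeight, Pi.mul_apply]; ring)
  have hrise : 0 ≤ deriv (smoothStep a (2 * a)) t := deriv_smoothStep_nonneg (by linarith)
  have hfall : 0 ≤ smoothStep a (2 * a) t * deriv (smoothStep t₂ b) t :=
    mul_nonneg smoothStep_nonneg (deriv_smoothStep_nonneg hb)
  have hexp_le : Real.exp (-(Λ + 1) * t) ≤ 1 := Real.exp_le_one_iff.2 (by nlinarith)
  have hbound : Real.exp (-(Λ + 1) * t) * (deriv (smoothStep a (2 * a)) t *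
      (1 - smoothStep t₂ b t) - smoothStep a (2 * a) t * deriv (smoothStep t₂ b) t) ≤
      deriv (smoothStep a (2 * a)) t :=
    calc _ ≤ Real.exp (-(Λ + 1) * t) * deriv (smoothStep a (2 * a)) t := by
          gcongr
          nlinarith [smoothStep_nonneg (s₀ := t₂) (s₁ := b) (t := t)]
      _ ≤ _ := mul_le_of_le_one_left hrise hexp_le
  linarith

variable {E : ℝ → ℝ}

theorem integral_gronwallWeight_mul_le (hΛ : 0 ≤ Λ) (ha : 0 < a) (hab : a ≤ b) (hb : t₂ < b)
    {κ : ℝ} (hE_nonneg : ∀ t, 0 ≤ E t) (hE : IntegrableOn E (Icc a b))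
    (hE_ineq : 0 ≤ ∫ t in Icc a b,
      (deriv (gronwallWeight Λ a t₂ b) t + Λ * gronwallWeight Λ a t₂ b t) * E t)
    (hκ : 0 ≤ κ) (hEκ : ∀ t ∈ Icc a (2 * a), E t ≤ κ) :
    ∫ t in Icc a b, gronwallWeight Λ a t₂ b t * E t ≤ κ := by
  have hint {g : ℝ → ℝ} (hg : Continuous g) : IntegrableOn (fun t => g t * E t) (Icc a b) :=
    hE.continuousOn_mul hg.continuousOn isCompact_Icc
  have hweight : Continuous (gronwallWeight Λ a t₂ b) :=
    (contDiff_gronwallWeight (m := 0)).continuous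
  have hweight' : Continuous (deriv (gronwallWeight Λ a t₂ b)) :=
    (contDiff_gronwallWeight (m := 1)).continuous_deriv le_rfl
  have hstep' : Continuous (deriv (smoothStep a (2 * a))) :=
    (contDiff_smoothStep (m := 1)).continuous_deriv le_rfl
  have hle : ∫ t in Icc a b, (deriv (gronwallWeight Λ a t₂ b) t + Λ * gronwallWeight Λ a t₂ b t) *
      E t ≤ ∫ t in Icc a b, (deriv (smoothStep a (2 * a)) t * E t -
        gronwallWeight Λ a t₂ b t * E t) := by
    refine setIntegral_mono_on (hint (hweight'.add (hweight.const_mul Λ)))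
      ((hint hstep').sub (hint hweight)) measurableSet_Icc fun t ht => ?_
    rw [← sub_mul]
    exact mul_le_mul_of_nonneg_right
      (deriv_gronwallWeight_add_le hΛ ha hb (ha.le.trans ht.1)) (hE_nonneg t)
  rw [integral_sub (hint hstep') (hint hweight)] at hle
  have hstep_le : ∫ t in Icc a b, deriv (smoothStep a (2 * a)) t * E t ≤ κ :=
    integral_deriv_smoothStep_mul_le (by linarith) hab hκ hE hEκ
  linarith

theorem exp_mul_integral_Icc_le (hΛ : 0 ≤ Λ) (ha : 0 < a) (hat : 2 * a ≤ t₁) (hb : t₂ < b)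
    (hE_nonneg : ∀ t, 0 ≤ E t) (hE : IntegrableOn E (Icc a b)) :
    Real.exp (-(Λ + 1) * t₂) * ∫ t in Icc t₁ t₂, E t ≤
      ∫ t in Icc a b, gronwallWeight Λ a t₂ b t * E t := by
  have hsub : Icc t₁ t₂ ⊆ Icc a b := Icc_subset_Icc (by linarith) hb.le
  have hint : IntegrableOn (fun t => gronwallWeight Λ a t₂ b t * E t) (Icc a b) :=
    hE.continuousOn_mul (contDiff_gronwallWeight (m := 0)).continuous.continuousOn isCompact_Icc
  rw [← integral_const_mul]
  calc ∫ t in Icc t₁ t₂, Real.exp (-(Λ + 1) * t₂) * E t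
      ≤ ∫ t in Icc t₁ t₂, gronwallWeight Λ a t₂ b t * E t := by
        refine setIntegral_mono_on ((hE.mono_set hsub).const_mul _) (hint.mono_set hsub)
          measurableSet_Icc fun t ht => ?_
        rw [gronwallWeight_of_mem_Icc ha hb ⟨hat.trans ht.1, ht.2⟩]
        exact mul_le_mul_of_nonneg_right (Real.exp_le_exp.2 (by nlinarith [ht.2])) (hE_nonneg t)
    _ ≤ ∫ t in Icc a b, gronwallWeight Λ a t₂ b t * E t :=
      setIntegral_mono_set hint
        (ae_of_all _ fun t => mul_nonneg gronwallWeight_nonneg (hE_nonneg t))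
        (ae_of_all _ hsub)

theorem integral_Icc_eq_zero_of_gronwall (hΛ : 0 ≤ Λ) (hE_nonneg : ∀ t, 0 ≤ E t)
    (hE_int : ∀ a b, 0 < a → b < T → IntegrableOn E (Icc a b))
    (hE_ineq : ∀ φ a b, 0 < a → b < T → ContDiff ℝ ∞ φ → (∀ t, 0 ≤ φ t) → support φ ⊆ Icc a b →
      0 ≤ ∫ t in Icc a b, (deriv φ t + Λ * φ t) * E t)
    (hE_zero : Tendsto E (𝓝[>] 0) (𝓝 0)) (ht₁ : 0 < t₁) (ht₂ : t₂ < T) :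
    ∫ t in Icc t₁ t₂, E t = 0 := by
  rcases lt_or_ge t₂ t₁ with ht | ht
  · rw [Icc_eq_empty ht.not_ge, Measure.restrict_empty, integral_zero_measure]
  have hle : Real.exp (-(Λ + 1) * t₂) * ∫ t in Icc t₁ t₂, E t ≤ 0 := by
    refine le_of_forall_pos_le_add fun κ hκ => ?_
    obtain ⟨δ, hδ, hEδ⟩ := mem_nhdsGT_iff_exists_Ioo_subset.1 (hE_zero.eventually_lt_const hκ)
    obtain ⟨a, ha, ha_lt⟩ := exists_between (lt_min (half_pos hδ) (half_pos ht₁))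
    obtain ⟨haδ, hat⟩ := lt_min_iff.1 ha_lt
    obtain ⟨b, hb, hbT⟩ := exists_between ht₂
    have hE := hE_int a b ha hbT
    rw [zero_add]
    exact (exp_mul_integral_Icc_le hΛ ha (by linarith) hb hE_nonneg hE).trans
      (integral_gronwallWeight_mul_le hΛ ha (by linarith) hb hE_nonneg hE
        (hE_ineq _ a b ha hbT contDiff_gronwallWeight (fun _ => gronwallWeight_nonneg)
          (support_gronwallWeight_subset ha hb)) hκ.le
        fun t htI => le_of_lt (hEδ ⟨ha.trans_le htI.1, by linarith [htI.2]⟩))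
  exact le_antisymm (nonpos_of_mul_nonpos_right hle (Real.exp_pos _))
    (integral_nonneg hE_nonneg)

end Gronwall

section MeanConvergence

variable {X : Type*} [MeasurableSpace X] {μ : Measure X} {E : Type*} [NormedAddCommGroup E]
  {p : ℝ}

theorem lintegral_enorm_le_of_norm_le_add_mul_rpow (hp : 0 < p) {f : X → ℝ} {g : X → E} {ε C : ℝ}
    (h : ∀ x, ‖f x‖ ≤ ε + C * ‖g x‖ ^ p) :
    ∫⁻ x, ‖f x‖ₑ ∂μ ≤
      ENNReal.ofReal ε * μ univ + ENNReal.ofReal C * eLpNorm g (ENNReal.ofReal p) μ ^ p := by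
  have hpow : ∫⁻ x, ‖g x‖ₑ ^ p ∂μ = eLpNorm g (ENNReal.ofReal p) μ ^ p := by
    rw [eLpNorm_eq_eLpNorm' (ENNReal.ofReal_pos.2 hp).ne' ENNReal.ofReal_ne_top,
      ENNReal.toReal_ofReal hp.le, lintegral_rpow_enorm_eq_rpow_eLpNorm' hp]
  rw [← hpow, ← lintegral_const, ← lintegral_const_mul' _ _ ENNReal.ofReal_ne_top,
    ← lintegral_add_left measurable_const]
  refine lintegral_mono fun x => ?_
  rw [← ofReal_norm, ← ofReal_norm, ENNReal.ofReal_rpow_of_nonneg (norm_nonneg _) hp.le,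
    ← ENNReal.ofReal_mul' (by positivity)]
  exact (ENNReal.ofReal_le_ofReal (h x)).trans ENNReal.ofReal_add_le

theorem tendsto_integral_zero_of_norm_le_add_mul_rpow [IsFiniteMeasure μ] (hp : 0 < p) {ι : Type*}
    {l : Filter ι} {f : ι → X → ℝ} {g : ι → X → E}
    (h : ∀ ε > 0, ∃ C, ∀ᶠ i in l, ∀ x, ‖f i x‖ ≤ ε + C * ‖g i x‖ ^ p)
    (hg : Tendsto (fun i => eLpNorm (g i) (ENNReal.ofReal p) μ) l (𝓝 0)) :
    Tendsto (fun i => ∫ x, f i x ∂μ) l (𝓝 0) := by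
  rw [tendsto_zero_iff_enorm_tendsto_zero, ENNReal.tendsto_nhds_zero]
  intro κ hκ
  have hε_lim : Tendsto (fun ε => ENNReal.ofReal ε * μ univ) (𝓝[>] 0) (𝓝 0) := by
    simpa using ENNReal.Tendsto.mul_const
      ((ENNReal.continuous_ofReal.tendsto 0).mono_left nhdsWithin_le_nhds)
      (Or.inr (measure_ne_top μ univ))
  obtain ⟨ε, hεκ, hε⟩ :=
    ((hε_lim.eventually_lt_const hκ).and self_mem_nhdsWithin).exists
  obtain ⟨C, hC⟩ := h ε hε
  have hbound_lim : Tendsto (fun i => ENNReal.ofReal ε * μ univ +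
      ENNReal.ofReal C * eLpNorm (g i) (ENNReal.ofReal p) μ ^ p) l
      (𝓝 (ENNReal.ofReal ε * μ univ)) := by
    simpa [hp] using tendsto_const_nhds.add
      (ENNReal.Tendsto.const_mul (hg.ennrpow_const p) (Or.inr (ENNReal.ofReal_ne_top (r := C))))
  filter_upwards [hC, hbound_lim.eventually_lt_const hεκ] with i hi hiκ
  exact (enorm_integral_le_lintegral_enorm _).trans
    ((lintegral_enorm_le_of_norm_le_add_mul_rpow hp hi).trans hiκ.le)

end MeanConvergence

section TimeSlices

variable {d : ℕ} {T a b : ℝ} {f : SpaceTime d → ℝ}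

theorem integrableOn_Icc_integral_slice (hf : IntegrableOn f (slab d a b)) :
    IntegrableOn (fun t => ∫ x, f (t, x)) (Icc a b) := by
  rw [IntegrableOn, slab, Measure.volume_eq_prod, ← Measure.prod_restrict,
    Measure.restrict_univ] at hf
  exact hf.integral_prod_left

theorem setIntegral_slab_comp_fst_mul {g : ℝ → ℝ} (hg : Continuous g)
    (hf : IntegrableOn f (slab d a b)) :
    ∫ z in slab d a b, g z.1 * f z = ∫ t in Icc a b, g t * ∫ x, f (t, x) := by
  have hfubini := setIntegral_prod (μ := volume) (ν := volume) _
    (integrableOn_slab_comp_fst_mul hg hf)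
  simp only [Measure.restrict_univ, integral_const_mul] at hfubini
  exact hfubini

theorem ae_cyl_of_ae_slab {P : SpaceTime d → Prop}
    (h : ∀ a b, 0 < a → b < T → ∀ᵐ z ∂volume.restrict (slab d a b), P z) :
    ∀ᵐ z ∂volume.restrict (cyl d T), P z := by
  have hslab (k : ℕ) :
      ∀ᵐ z, z ∈ slab d (1 / ((k : ℝ) + 1)) (T - 1 / ((k : ℝ) + 1)) → P z :=
    (ae_restrict_iff' (measurableSet_slab _ _)).1
      (h _ _ Nat.one_div_pos_of_nat (sub_lt_self _ Nat.one_div_pos_of_nat))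
  have hpos : ∀ᵐ z : SpaceTime d, z.1 ≠ 0 :=
    Measure.quasiMeasurePreserving_fst.ae (Measure.ae_ne volume 0)
  rw [ae_restrict_iff' measurableSet_cyl]
  filter_upwards [ae_all_iff.2 hslab, hpos] with z hz hz₀ hzT
  have hlim := tendsto_one_div_add_atTop_nhds_zero_nat (𝕜 := ℝ)
  obtain ⟨k, hk₀, hkT⟩ := ((hlim.eventually_lt_const (hzT.1.1.lt_of_ne' hz₀)).and
    (hlim.eventually_lt_const (sub_pos.2 hzT.1.2))).exists
  exact hz k (mem_slab.2 ⟨hk₀.le, by linarith⟩)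

theorem ae_eq_zero_of_gronwall {Λ : ℝ} (hΛ : 0 ≤ Λ) (hf_nonneg : ∀ z, 0 ≤ f z)
    (hf_int : ∀ a b, 0 < a → b < T → IntegrableOn f (slab d a b))
    (hf_ineq : ∀ φ a b, 0 < a → b < T → ContDiff ℝ ∞ φ → (∀ t, 0 ≤ φ t) →
      Function.support φ ⊆ Icc a b → 0 ≤ ∫ z in slab d a b, (deriv φ z.1 + Λ * φ z.1) * f z)
    (hf_zero : Tendsto (fun t => ∫ x, f (t, x)) (𝓝[>] 0) (𝓝 0)) :
    ∀ᵐ z ∂volume.restrict (cyl d T), f z = 0 := by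
  refine ae_cyl_of_ae_slab fun t₁ t₂ ht₁ ht₂ => ?_
  have hE_ineq (φ : ℝ → ℝ) (a b : ℝ) (ha : 0 < a) (hb : b < T) (hφ : ContDiff ℝ ∞ φ)
      (hφ_nonneg : ∀ t, 0 ≤ φ t) (hφ_supp : Function.support φ ⊆ Icc a b) :
      0 ≤ ∫ t in Icc a b, (deriv φ t + Λ * φ t) * ∫ x, f (t, x) := by
    have hφ' : Continuous fun t => deriv φ t + Λ * φ t :=
      (hφ.continuous_deriv (by exact_mod_cast le_top)).add (hφ.continuous.const_mul Λ)
    rw [← setIntegral_slab_comp_fst_mul hφ' (hf_int a b ha hb)]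
    exact hf_ineq φ a b ha hb hφ hφ_nonneg hφ_supp
  have hzero : ∫ z in slab d t₁ t₂, f z = 0 :=
    calc ∫ z in slab d t₁ t₂, f z = ∫ z in slab d t₁ t₂, 1 * f z := by simp only [one_mul]
      _ = ∫ t in Icc t₁ t₂, 1 * ∫ x, f (t, x) :=
        setIntegral_slab_comp_fst_mul continuous_const (hf_int t₁ t₂ ht₁ ht₂)
      _ = 0 := by
        simp only [one_mul]
        exact integral_Icc_eq_zero_of_gronwall hΛ
          (fun t => integral_nonneg fun x => hf_nonneg (t, x))
          (fun a b ha hb => integrableOn_Icc_integral_slice (hf_int a b ha hb)) hE_ineq hf_zero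
          ht₁ ht₂
  exact (setIntegral_eq_zero_iff_of_nonneg_ae (ae_of_all _ hf_nonneg)
    (hf_int t₁ t₂ ht₁ ht₂)).1 hzero

end TimeSlices

/-! ### Weak-strong uniqueness -/

section InitialTrace

variable {X : Type*} [MeasurableSpace X] {μ : Measure X} [IsFiniteMeasure μ]
  {E H : Type*} [NormedAddCommGroup E] [NormedAddCommGroup H] [InnerProductSpace ℝ H]
  {A G : E → H} {η : E → ℝ} {K : Set E} {p β : ℝ}

theorem tendsto_integral_relEnt_zero_of_isCompact (hAη : A =o[cocompact E] η)
    (hη : Tendsto η (cocompact E) atTop) (hη_nonneg : ∀ u, 0 ≤ η u) (hK : IsCompact K)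
    (hA_cont : Continuous A) (hη_cont : Continuous η) (hG_cont : Continuous G)
    (hrel : ∀ u v, 0 ≤ relEnt A η G u v) (hp : 0 < p) (hη_le : ∀ u, η u ≤ β * (‖u‖ ^ p + 1))
    {ι : Type*} {l : Filter ι} {u v : ι → X → E} (hv : ∀ᶠ i in l, ∀ x, v i x ∈ K)
    (huv : Tendsto (fun i => eLpNorm (u i - v i) (ENNReal.ofReal p) μ) l (𝓝 0)) :
    Tendsto (fun i => ∫ x, relEnt A η G (u i x) (v i x) ∂μ) l (𝓝 0) := by
  refine tendsto_integral_zero_of_norm_le_add_mul_rpow hp (fun ε hε => ?_) huv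
  obtain ⟨C, hC⟩ := exists_relEnt_le_add_mul_norm_sub_rpow hAη hη hη_nonneg hK hA_cont hη_cont
    hG_cont hp hη_le hε
  refine ⟨C, hv.mono fun i hi x => ?_⟩
  rw [Real.norm_of_nonneg (hrel _ _)]
  exact hC _ (hi x) _

variable {d : ℕ} {T : ℝ}

theorem tendsto_eLpNorm_slice_sub {v : SpaceTime d → E} (hv : ContinuousOn v (closedCyl d T))
    {s : ℝ} (hs : s ∈ Icc 0 T) (q : ENNReal) :
    Tendsto (fun t => eLpNorm (fun x => v (s, x) - v (t, x)) q volume) (𝓝[Icc 0 T] s) (𝓝 0) := by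
  have hunif := (isCompact_slab 0 T).uniformContinuousOn_of_continuous hv
  have hbound_lim : Tendsto (fun ε : ℝ => (volume : Measure (Torus d)) univ ^ q.toReal⁻¹ *
      ENNReal.ofReal ε) (𝓝[>] 0) (𝓝 0) := by
    simpa using ENNReal.Tendsto.const_mul
      ((ENNReal.continuous_ofReal.tendsto 0).mono_left nhdsWithin_le_nhds)
      (Or.inr (ENNReal.rpow_ne_top_of_nonneg (by positivity) (measure_ne_top _ _)))
  refine ENNReal.tendsto_nhds_zero.2 fun κ hκ => ?_
  obtain ⟨ε, hεκ, hε⟩ := ((hbound_lim.eventually_le_const hκ).and self_mem_nhdsWithin).exists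
  obtain ⟨δ, hδ, hdist⟩ := Metric.uniformContinuousOn_iff_le.1 hunif ε hε
  filter_upwards [self_mem_nhdsWithin,
    mem_nhdsWithin_of_mem_nhds (Metric.closedBall_mem_nhds s hδ)] with t ht hts
  refine (eLpNorm_le_of_ae_bound (ae_of_all _ fun x => ?_)).trans hεκ
  rw [← dist_eq_norm]
  refine hdist (s, x) (mem_slab.2 hs) (t, x) (mem_slab.2 ht) ?_
  rw [Prod.dist_eq, dist_self, dist_comm, max_eq_left dist_nonneg]
  exact hts

theorem IsContLp.tendsto_eLpNorm_sub (hT : 0 < T) (hp : 1 ≤ p) {n : ℕ}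
    {u v : SpaceTime d → State n}
    (hu : IsContLp T p u) (hv : ContinuousOn v (closedCyl d T))
    (huv : ∀ᵐ x : Torus d, u (0, x) = v (0, x)) :
    Tendsto (fun t => eLpNorm (fun x => u (t, x) - v (t, x)) (ENNReal.ofReal p) volume) (𝓝[>] 0)
      (𝓝 0) := by
  have h0 : (0 : ℝ) ∈ Icc 0 T := left_mem_Icc.2 hT.le
  have hv_meas {t : ℝ} (ht : t ∈ Icc 0 T) : AEStronglyMeasurable fun x : Torus d => v (t, x) :=
    (hv.comp_continuous (by fun_prop) fun x => ⟨ht, mem_univ x⟩).aestronglyMeasurable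
  have hsum := (hu.cont 0 h0).add (tendsto_eLpNorm_slice_sub hv h0 (ENNReal.ofReal p))
  rw [add_zero] at hsum
  rw [← nhdsWithin_Ioc_eq_nhdsGT hT]
  refine tendsto_of_tendsto_of_tendsto_of_le_of_le' tendsto_const_nhds
    (hsum.mono_left (nhdsWithin_mono 0 Ioc_subset_Icc_self)) (Eventually.of_forall fun _ => zero_le)
    ?_
  filter_upwards [self_mem_nhdsWithin] with t ht
  have ht' := Ioc_subset_Icc_self ht
  calc eLpNorm (fun x => u (t, x) - v (t, x)) (ENNReal.ofReal p) volume
      = eLpNorm ((fun x => u (t, x) - u (0, x)) + fun x => v (0, x) - v (t, x))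
          (ENNReal.ofReal p) volume :=
        eLpNorm_congr_ae (huv.mono fun x hx => by simp [hx])
    _ ≤ _ := eLpNorm_add_le
        ((hu.memLp t ht').aestronglyMeasurable.sub (hu.memLp 0 h0).aestronglyMeasurable)
        ((hv_meas h0).sub (hv_meas ht')) (ENNReal.one_le_ofReal.2 hp)

end InitialTrace

section Growth

variable {E F : Type*} [NormedAddCommGroup F] {A : E → F} {η : E → ℝ} {l : Filter E}

theorem tendsto_atTop_of_isLittleO (hA : Tendsto (fun u => ‖A u‖) l atTop)
    (hη_nonneg : ∀ u, 0 ≤ η u) (hAη : A =o[l] η) : Tendsto η l atTop := by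
  refine tendsto_atTop_mono' l ?_ hA
  filter_upwards [hAη.bound one_pos] with u hu
  rwa [one_mul, Real.norm_of_nonneg (hη_nonneg u)] at hu

theorem tendsto_cobounded_of_le_rpow {r C : ℝ} (hr : 0 ≤ r) (hC : 0 ≤ C)
    (h : ∀ u, η u ≤ C * (‖A u‖ ^ r + 1)) (hη : Tendsto η l atTop) :
    Tendsto A l (Bornology.cobounded F) := by
  rw [← tendsto_norm_atTop_iff_cobounded]
  refine tendsto_atTop.2 fun M => ?_
  filter_upwards [hη.eventually_gt_atTop (C * (|M| ^ r + 1))] with u hu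
  by_contra! hM
  have hle : ‖A u‖ ^ r ≤ |M| ^ r := by
    gcongr
    exact hM.le.trans (le_abs_self M)
  exact (hu.trans_le (h u)).not_ge (by gcongr)

theorem tendsto_cobounded_atTop_of_rpow_le [NormedAddCommGroup E] {p β B : ℝ} (hp : 0 < p)
    (hβ : 0 < β) (h : ∀ u, β * (‖u‖ ^ p + 1) - B ≤ η u) : Tendsto η (Bornology.cobounded E) atTop :=
  tendsto_atTop_mono h <| tendsto_atTop_add_const_right _ _ <| Tendsto.const_mul_atTop hβ <|
    tendsto_atTop_add_const_right _ _ <| (tendsto_rpow_atTop hp).comp tendsto_norm_cobounded_atTop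

end Growth

section Solutions

open Function

variable {n d : ℕ} {T : ℝ} {A : State n → State n} {F : Fin d → State n → State n}
  {η : State n → ℝ} {q : Fin d → State n → ℝ} {G : State n → State n}
  {u v : SpaceTime d → State n}

theorem IsEntropyPair.isMultiplier (h : IsEntropyPair A F η q G) (hA : ContDiff ℝ 2 A)
    (hF : ∀ α, ContDiff ℝ 2 (F α)) :
    IsMultiplier (fun i : Option (Fin d) => i.elim A F) (fun i => i.elim η q) G where
  contDiff_flux := Option.forall.2 ⟨hA, hF⟩
  contDiff_entropyFlux := Option.forall.2 ⟨h.smooth_η.of_le one_le_two, h.smooth_q⟩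
  contDiff_multiplier := h.smooth_G
  fderiv_entropyFlux := Option.forall.2 ⟨h.grad_η, h.grad_q⟩

theorem IsWeakSolution.locallyIntegrableOn_flux (hu : IsWeakSolution T A F u)
    (i : Option (Fin d)) : LocallyIntegrableOn (fun z => i.elim A F (u z)) (openCyl d T) := by
  cases i with
  | none => exact hu.locInt_A
  | some α => exact hu.locInt_F α

theorem IsWeakSolution.sum_integral_pderiv_smul_flux (hu : IsWeakSolution T A F u)
    {φ : SpaceTime d → ℝ} (hφ : IsTest T φ) :
    ∑ i, ∫ z in cyl d T, pderiv i φ z • i.elim A F (u z) = 0 := by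
  obtain ⟨a, b, ha, hb, hφ_supp⟩ := hφ.exists_support_subset_slab
  have hsupp (i : Option (Fin d)) :
      support (fun z => pderiv i φ z • i.elim A F (u z)) ⊆ slab d a b :=
    (support_smul_subset_left _ _).trans (support_pderiv_subset_slab hφ_supp i)
  have hint (i : Option (Fin d)) :
      IntegrableOn (fun z => pderiv i φ z • i.elim A F (u z)) (cyl d T) :=
    ((integrableOn_iff_integrable_of_support_subset (hsupp i)).1 <|
      (integrableOn_slab (hu.locallyIntegrableOn_flux i) ha hb).continuousOn_smul
        (hφ.isC1.continuous_pderiv i).continuousOn (isCompact_slab a b)).integrableOn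
  rw [← integral_finsetSum _ fun i _ => hint i, ← hu.eqn φ hφ]
  simp only [Fintype.sum_option, pderiv_none, pderiv_some, Option.elim]

theorem IsEntropyWeakSolution.integral_deriv_mul_entropy_nonneg
    (hu : IsEntropyWeakSolution T A F η q u) {a b : ℝ} (ha : 0 < a) (hb : b < T) {φ : ℝ → ℝ}
    (hφ : ContDiff ℝ ∞ φ) (hφ_nonneg : ∀ t, 0 ≤ φ t) (hφ_supp : support φ ⊆ Icc a b) :
    0 ≤ ∫ z in slab d a b, deriv φ z.1 * η (u z) := by
  have hineq := hu.entropy _ (isTest_comp_fst hφ ha hb hφ_supp) fun z => hφ_nonneg z.1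
  simp only [← pderiv_none, ← pderiv_some, pderiv_none_comp_fst, pderiv_some_comp_fst, zero_mul,
    Finset.sum_const_zero, add_zero] at hineq
  rwa [setIntegral_cyl_eq_slab ha hb ((support_mul_subset_left _ _).trans
    (support_comp_fst_subset_slab (support_deriv_subset_Icc hφ_supp)))] at hineq

theorem IsStrongSolution.exists_hasWeakGrad (hv : IsStrongSolution T A F v) :
    ∃ w, HasWeakGrad T v w ∧ ∀ᵐ z ∂volume.restrict (cyl d T),
      ∑ i : Option (Fin d), fderiv ℝ (i.elim A F) (v z) (w i z) = 0 := by
  obtain ⟨wt, wx, hwt, hwt_eq, hwx, heqn⟩ := hv.eqn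
  refine ⟨fun i => i.elim wt wx, ⟨hv.bdd, Option.forall.2 ⟨hwt, fun α => (hwx α).1⟩,
    Option.forall.2 ⟨fun φ hφ => ?_, fun α φ hφ => ?_⟩⟩, ?_⟩
  · rw [pderiv_none]
    exact hwt_eq φ hφ
  · rw [pderiv_some]
    exact (hwx α).2 φ hφ
  · simpa only [Fintype.sum_option, Option.elim] using heqn

end Solutions

section WeakStrongUniqueness

variable {n d : ℕ} {T p β : ℝ} {A : State n → State n} {F : Fin d → State n → State n}
  {η : State n → ℝ} {q : Fin d → State n → ℝ} {G : State n → State n}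
  {u ubar : SpaceTime d → State n}

theorem IsStrongSolution.tendsto_integral_relEnt_zero (hT : 0 < T)
    (hubar : IsStrongSolution T A F ubar) (hA : Continuous A) (hη : Continuous η)
    (hG : Continuous G) (hη_nonneg : ∀ u, 0 ≤ η u) (hη_top : Tendsto η (cocompact _) atTop)
    (hAη : A =o[cocompact _] η) (hrel : ∀ u v, 0 ≤ relEnt A η G u v) (hp : 0 < p)
    (hη_le : ∀ u, η u ≤ β * (‖u‖ ^ p + 1))
    (h_init : Tendsto (fun t => eLpNorm (fun x => u (t, x) - ubar (t, x)) (ENNReal.ofReal p) volume)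
      (𝓝[>] 0) (𝓝 0)) :
    Tendsto (fun t => ∫ x, relEnt A η G (u (t, x)) (ubar (t, x))) (𝓝[>] 0) (𝓝 0) := by
  refine tendsto_integral_relEnt_zero_of_isCompact hAη hη_top hη_nonneg
    ((isCompact_slab 0 T).image_of_continuousOn hubar.cont) hA hη hG hrel hp hη_le ?_ h_init
  filter_upwards [Ioo_mem_nhdsGT hT] with t ht x
  exact mem_image_of_mem ubar (mem_slab.2 (Ioo_subset_Icc_self ht))

theorem IsEntropyWeakSolution.exists_relEnt_inequality (hu : IsEntropyWeakSolution T A F η q u)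
    (hubar : IsStrongSolution T A F ubar) (h_pair : IsEntropyPair A F η q G)
    (hF : ∀ α, ContDiff ℝ 2 (F α)) (hconv : IsConvexEntropy A η G) {S : State n → State n}
    (hS : ContDiff ℝ 2 S) (hSA : Function.LeftInverse S A) (hAS : Function.RightInverse S A)
    (hη_top : Tendsto η (cocompact _) atTop) (hAη : A =o[cocompact _] η)
    (hFη : ∀ α, F α =o[cocompact _] η) :
    ∃ Λ ≥ 0, ∀ φ a b, 0 < a → b < T → ContDiff ℝ ∞ φ → (∀ t, 0 ≤ φ t) →
      Function.support φ ⊆ Icc a b →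
      0 ≤ ∫ z in slab d a b, (deriv φ z.1 + Λ * φ z.1) * relEnt A η G (u z) (ubar z) := by
  obtain ⟨w, hw, hw_eqn⟩ := hubar.exists_hasWeakGrad
  have hmul := h_pair.isMultiplier hconv.contDiff_conserved hF
  have hubar_mem : ∀ᵐ z ∂volume.restrict (cyl d T), ubar z ∈ ubar '' closedCyl d T :=
    (ae_restrict_mem measurableSet_cyl).mono fun z hz =>
      mem_image_of_mem ubar (prod_mono Ico_subset_Icc_self subset_rfl hz)
  obtain ⟨Λ, hΛ, hflux⟩ := hw.exists_ae_abs_sum_inner_le_relEnt hmul hconv hS hSA hAS hη_top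
    (Option.forall.2 ⟨hAη, hFη⟩) ((isCompact_slab 0 T).image_of_continuousOn hubar.cont)
    hubar_mem hw_eqn
  exact ⟨Λ, hΛ, fun φ a b ha hb hφ hφ_nonneg hφ_supp =>
    hw.integral_deriv_add_mul_relEnt_nonneg hmul hw_eqn hu.locallyIntegrableOn_flux
      (fun ψ hψ => hu.sum_integral_pderiv_smul_flux hψ) hu.locInt_η (hflux u) ha hb hφ hφ_supp
      hφ_nonneg (hu.integral_deriv_mul_entropy_nonneg ha hb hφ hφ_nonneg hφ_supp)⟩

theorem mainTheorem9_general (hT : 0 < T) (hp : 0 < p) (hA : ContDiff ℝ 2 A)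
    (hF : ∀ α, ContDiff ℝ 2 (F α)) (hA_inj : Function.Injective A)
    (hA_nonsing : ∀ u, Function.Bijective (fderiv ℝ A u))
    (hA_top : Tendsto A (Bornology.cobounded (State n)) (Bornology.cobounded (State n)))
    (h_pair : IsEntropyPair A F η q G)
    (h_posdef : ∀ u ξ, ξ ≠ 0 →
      0 < fderiv ℝ (fderiv ℝ η) u ξ ξ - inner ℝ (G u) (fderiv ℝ (fderiv ℝ A) u ξ ξ))
    (hη_nonneg : ∀ u, 0 ≤ η u) (hη_le : ∀ u, η u ≤ β * (‖u‖ ^ p + 1))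
    (h_growth_F : ∀ α, F α =o[Bornology.cobounded (State n)] η)
    (h_growth_A : A =o[Bornology.cobounded (State n)] η)
    (hu : IsEntropyWeakSolution T A F η q u) (hubar : IsStrongSolution T A F ubar)
    (h_init : Tendsto (fun t => eLpNorm (fun x => u (t, x) - ubar (t, x)) (ENNReal.ofReal p) volume)
      (𝓝[>] 0) (𝓝 0)) :
    ∀ᵐ z ∂(volume.restrict (cyl d T)), u z = ubar z := by
  have hη_top := tendsto_atTop_of_isLittleO (tendsto_norm_atTop_iff_cobounded.2 hA_top) hη_nonneg
    h_growth_A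
  rw [Metric.cobounded_eq_cocompact] at hA_top hη_top h_growth_A
  simp only [Metric.cobounded_eq_cocompact] at h_growth_F
  obtain ⟨S, hS, hSA, hAS⟩ :=
    exists_contDiff_inverse_of_tendsto_cocompact hA two_ne_zero hA_inj hA_nonsing hA_top
  have hconv : IsConvexEntropy A η G :=
    ⟨hA, h_pair.smooth_η, h_pair.smooth_G, h_pair.grad_η, h_posdef⟩
  have hrel := hconv.relEnt_nonneg hS hSA hAS
  obtain ⟨w, hw, -⟩ := hubar.exists_hasWeakGrad
  have hrel_int (a b : ℝ) (ha : 0 < a) (hb : b < T) :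
      IntegrableOn (fun z => relEnt A η G (u z) (ubar z)) (slab d a b) :=
    hw.integrableOn_relEnt_comp hA.continuous h_pair.smooth_η.continuous
      h_pair.smooth_G.continuous hu.locInt_A hu.locInt_η ha hb
  obtain ⟨Λ, hΛ, hineq⟩ := hu.exists_relEnt_inequality hubar h_pair hF hconv hS hSA hAS hη_top
    h_growth_A h_growth_F
  have hrel_init := hubar.tendsto_integral_relEnt_zero hT hA.continuous
    h_pair.smooth_η.continuous h_pair.smooth_G.continuous hη_nonneg hη_top h_growth_A hrel hp hη_le
    h_init
  exact (ae_eq_zero_of_gronwall hΛ (fun z => hrel _ _) hrel_int hineq hrel_init).mono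
    fun z => hconv.eq_of_relEnt_eq_zero hS hSA hAS

end WeakStrongUniqueness

end HypCL

end

theorem mainTheorem9 {n d : ℕ} {T p : ℝ} (hT : 0 < T) (hp : 1 < p)
    (A : State n → State n) (F : Fin d → State n → State n)
    (η : State n → ℝ) (q : Fin d → State n → ℝ) (G : State n → State n)
    (hA : ContDiff ℝ 2 A) (hF : ∀ α, ContDiff ℝ 2 (F α))
    (hA_inj : Function.Injective A)
    (hA_nonsing : ∀ u, Function.Bijective (fderiv ℝ A u))
    (h_pair : IsEntropyPair A F η q G)
    (h_posdef : ∀ u ξ, ξ ≠ 0 →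
      0 < fderiv ℝ (fderiv ℝ η) u ξ ξ - inner ℝ (G u) (fderiv ℝ (fderiv ℝ A) u ξ ξ))
    (hη_nonneg : ∀ u, 0 ≤ η u)
    (h_growth_η : ∃ β₁ β₂ B : ℝ, 0 < β₁ ∧ 0 < β₂ ∧ 0 < B ∧
      ∀ u, β₁ * (‖u‖ ^ p + 1) - B ≤ η u ∧ η u ≤ β₂ * (‖u‖ ^ p + 1))
    (h_growth_F : ∀ α, Asymptotics.IsLittleO (Bornology.cobounded (State n)) (F α) η)
    (h_growth_A : Asymptotics.IsLittleO (Bornology.cobounded (State n)) A η)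
    (h_growth_H : ∃ r C B : ℝ, 1 < r ∧ 0 < C ∧ 0 < B ∧
      ∀ u, 1 / C * (‖A u‖ ^ r + 1) - B ≤ η u ∧ η u ≤ C * (‖A u‖ ^ r + 1))
    (u ubar : ℝ × Torus d → State n)
    (hu_cont : IsContLp T p u)
    (hu : IsEntropyWeakSolution T A F η q u)
    (hubar : IsStrongSolution T A F ubar)
    (h_init : ∀ᵐ x : Torus d, u (0, x) = ubar (0, x)) :
    ∀ᵐ z ∂(volume.restrict (cyl d T)), u z = ubar z := by
  obtain ⟨β₁, β₂, B, hβ₁, -, -, hη⟩ := h_growth_η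
  obtain ⟨r, C, B', hr, hC, -, hA_growth⟩ := h_growth_H
  have hη_top := tendsto_cobounded_atTop_of_rpow_le (one_pos.trans hp) hβ₁ fun u => (hη u).1
  have hA_top := tendsto_cobounded_of_le_rpow (one_pos.trans hr).le hC.le
    (fun u => (hA_growth u).2) hη_top
  exact mainTheorem9_general hT (one_pos.trans hp) hA hF hA_inj hA_nonsing hA_top h_pair h_posdef
    hη_nonneg (fun u => (hη u).2) h_growth_F h_growth_A hu hubar
    (hu_cont.tendsto_eLpNorm_sub hT hp.le hubar.cont h_init)
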